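/- Let $n\ge 0$, let $\mathcal M$ be a connected complex manifold, let $\pi:V\to\mathcal M$ be a holomorphic vector bundle of rank $n$ (so $V$ is also a complex manifold) and let $\mathcal V$ be its sheaf of holomorphic sections. Let $\Lambda\subset\mathcal V$ be a subsheaf of abelian groups, locally isomorphic to the constant sheaf $\mathbf Z^{2n}$, such that for every $q\in\mathcal M$ the image of the evaluation map $\Lambda_q\to V_q$ is a lattice in $V_q$; this map is then injective, and we regard $\Lambda_q$ as a subgroup of $V_q$. Let $\langle\ ,\ \rangle:\Lambda\times\Lambda\to\mathbf Z$ be a symplectic form (bilinear, alternating, nondegenerate). Fix $p\in\mathcal M$, let $\rho:\pi_1(\mathcal M,p)\to\operatorname{Aut}(\Lambda_p)$ be the monodromy representation, and let $\delta_1,\dots,\delta_n\in\Lambda_p$ satisfy $\langle\delta_i,\delta_j\rangle=0$ for all $i,j$. Assume that each transvection $T_i(\gamma)=\gamma+\langle\gamma,\delta_i\rangle\delta_i$ of $\Lambda_p$ lies in the image of $\rho$, and that for every $q\in\mathcal M$ and every path from $p$ to $q$ the elements of $\Lambda_q$ obtained by transporting $\delta_1,\dots,\delta_n$ along the path form a complex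 basis of $V_q$. Let $f$ be a meromorphic function on $V$ whose restriction $f_q$ to each fibre $V_q$ is invariant under translation by $\Lambda_q$. Put $\delta=\delta_1+2\delta_2+\dots+n\delta_n$, and let $W\subset V$ be the holomorphic subbundle generated by $\delta$, i.e. the smallest holomorphic subbundle containing $\delta$ and all its continuations along paths in $\mathcal M$. Assume that $W$ is good: for every $q$, $f$ is constant on all cosets of $W_q$ in $V_q$, and $\Lambda_q\cap W_q$ spans $W_q$ over $\mathbf C$. Then $f_q$ is constant on $V_q$ for every $q\in\mathcal M$. (Values of $f$ are taken and compared only at points near which $f$ is holomorphic.) -/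

import Mathlib

open Bundle Set Filter Topology
open scoped Manifold ContDiff

/-! ### Meromorphic functions on complex manifolds -/

section Meromorphic

variable {E : Type*} [NormedAddCommGroup E] [NormedSpace ℂ E]
  {H : Type*} [TopologicalSpace H] (I : ModelWithCorners ℂ E H)
  {X : Type*} [TopologicalSpace X] [ChartedSpace H X]

/-- `f` is a meromorphic function on the complex manifold `X`: near every point there are
holomorphic functions `g` and `h`, with `h` not identically zero on any nonempty open set, such that
`f = g / h` wherever `h ≠ 0`. The values of the representative `f : X → ℂ` outside the set
`regularLocus I f` carry no information. -/
def IsMeromorphicFun (f : X → ℂ) : Prop :=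
  ∀ x : X, ∃ U : Set X, IsOpen U ∧ x ∈ U ∧ ∃ g h : X → ℂ,
    ContMDiffOn I 𝓘(ℂ) ω g U ∧ ContMDiffOn I 𝓘(ℂ) ω h U ∧
    (∀ y ∈ U, ∃ᶠ z in 𝓝 y, h z ≠ 0) ∧
    ∀ y ∈ U, h y ≠ 0 → f y = g y / h y

/-- The set of points near which `f` is holomorphic. It is open, and it is dense
if `f` is meromorphic. -/
def regularLocus (f : X → ℂ) : Set X :=
  {x | ContMDiffAt I 𝓘(ℂ) ω f x}

end Meromorphic

/-! ### Holomorphic sections and subbundles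

`M` is a complex manifold modelled on `E`, and `V` is a holomorphic vector bundle over `M` with
model fibre `F`; the total space `TotalSpace F V` is the physical bundle. -/

section Bundles

variable (E : Type*) [NormedAddCommGroup E] [NormedSpace ℂ E]
  (F : Type*) [NormedAddCommGroup F] [NormedSpace ℂ F]
  {M : Type*} [TopologicalSpace M] [ChartedSpace E M]
  (V : M → Type*) [∀ x, AddCommGroup (V x)] [∀ x, Module ℂ (V x)]
  [TopologicalSpace (TotalSpace F V)] [∀ x, TopologicalSpace (V x)]
  [FiberBundle F V]

/-- `s` is a holomorphic section of `V` over the open set `U`. -/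
def IsHolomorphicSection (U : TopologicalSpace.Opens M) (s : ∀ x : U, V x) : Prop :=
  ContMDiff 𝓘(ℂ, E) (𝓘(ℂ, E).prod 𝓘(ℂ, F)) ω (fun x : U => (⟨x, s x⟩ : TotalSpace F V))

/-- The family of complex subspaces `W q ⊆ V q` is a holomorphic subbundle of `V`: locally on `M` it
has a holomorphic frame. -/
def IsHolomorphicSubbundle (W : ∀ q, Submodule ℂ (V q)) : Prop :=
  ∀ q : M, ∃ U : TopologicalSpace.Opens M, q ∈ U ∧ ∃ (k : ℕ) (w : Fin k → ∀ x : U, V x),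
    (∀ i, IsHolomorphicSection E F V U (w i)) ∧
    ∀ x : U, LinearIndependent ℂ (fun i => w i x) ∧
      Submodule.span ℂ (range fun i => w i x) = W x

/-! ### The sheaf of lattices -/

/-- A subsheaf `Λ` of the sheaf of holomorphic sections of `V` (as sheaves of abelian groups), which
is locally isomorphic to the constant sheaf `ℤ ^ (2 * n)`, and such that at every point `q` the
values at `q` of its local sections near `q` form a lattice in `V q`. -/
structure LatticeSheaf (n : ℕ) where
  /-- The group of sections of `Λ` over `U`. -/
  sec : ∀ U : TopologicalSpace.Opens M, AddSubgroup (∀ x : U, V x)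
  holomorphic : ∀ U, ∀ s ∈ sec U, IsHolomorphicSection E F V U s
  restrict : ∀ (U U' : TopologicalSpace.Opens M) (hU : U' ≤ U), ∀ s ∈ sec U,
    (fun x : U' => s ⟨x, hU x.2⟩) ∈ sec U'
  glue : ∀ (U : TopologicalSpace.Opens M) (s : ∀ x : U, V x),
    (∀ x : U, ∃ (U' : TopologicalSpace.Opens M) (hU : U' ≤ U), (x : M) ∈ U' ∧
      (fun y : U' => s ⟨y, hU y.2⟩) ∈ sec U') → s ∈ sec U
  /-- Near each point there are sections `b i` such that `c ↦ ∑ i, c i • b i` is an isomorphism from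
  the constant sheaf `ℤ ^ (2 * n)` (the sheaf of locally constant functions `c`) to `Λ`. -/
  locally_const : ∀ q : M, ∃ U : TopologicalSpace.Opens M, q ∈ U ∧
    ∃ b : Fin (2 * n) → ∀ x : U, V x, (∀ i, b i ∈ sec U) ∧
      ∀ (U' : TopologicalSpace.Opens M) (hU : U' ≤ U), ∀ t ∈ sec U',
        ∃! c : LocallyConstant U' (Fin (2 * n) → ℤ),
          ∀ x : U', t x = ∑ i, c x i • b i ⟨x, hU x.2⟩
  /-- The values at `q` form a discrete subset of `V q`. -/
  discrete : ∀ q : M, DiscreteTopology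
    {v : V q | ∃ (U : TopologicalSpace.Opens M) (hq : q ∈ U), ∃ s ∈ sec U, s ⟨q, hq⟩ = v}
  /-- The values at `q` span `V q` over the real numbers. -/
  span_real : ∀ q : M, Submodule.span ℝ
    {v : V q | ∃ (U : TopologicalSpace.Opens M) (hq : q ∈ U), ∃ s ∈ sec U, s ⟨q, hq⟩ = v} = ⊤

end Bundles

namespace LatticeSheaf

variable {E : Type*} [NormedAddCommGroup E] [NormedSpace ℂ E]
  {F : Type*} [NormedAddCommGroup F] [NormedSpace ℂ F]
  {M : Type*} [TopologicalSpace M] [ChartedSpace E M]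
  {V : M → Type*} [∀ x, AddCommGroup (V x)] [∀ x, Module ℂ (V x)]
  [TopologicalSpace (TotalSpace F V)] [∀ x, TopologicalSpace (V x)]
  [FiberBundle F V] {n : ℕ}

/-- The image of the stalk `Λ_q` in `V q` under evaluation at `q`. As `Λ_q ≅ ℤ ^ (2 * n)` and
the image is a lattice in the `n`-dimensional complex vector space `V q`, evaluation is injective, so
this group is identified with the stalk `Λ_q`. -/
def stalk (Λ : LatticeSheaf E F V n) (q : M) : AddSubgroup (V q) where
  carrier := {v : V q | ∃ (U : TopologicalSpace.Opens M) (hq : q ∈ U),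
    ∃ s ∈ Λ.sec U, s ⟨q, hq⟩ = v}
  zero_mem' := ⟨⊤, trivial, 0, (Λ.sec ⊤).zero_mem, rfl⟩
  add_mem' := by
    rintro _ _ ⟨U, hU, s, hs, rfl⟩ ⟨U', hU', s', hs', rfl⟩
    exact ⟨U ⊓ U', ⟨hU, hU'⟩, _, (Λ.sec (U ⊓ U')).add_mem
      (Λ.restrict U (U ⊓ U') inf_le_left s hs) (Λ.restrict U' (U ⊓ U') inf_le_right s' hs'), rfl⟩
  neg_mem' := by
    rintro _ ⟨U, hU, s, hs, rfl⟩
    exact ⟨U, hU, -s, (Λ.sec U).neg_mem hs, rfl⟩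

/-- The germ at `x` of a section over `U`. -/
def germ (Λ : LatticeSheaf E F V n) {U : TopologicalSpace.Opens M} (s : Λ.sec U) (x : U) :
    Λ.stalk (x : M) :=
  ⟨s.1 x, U, x.2, s.1, s.2, rfl⟩

/-- A symplectic form on the sheaf `Λ`: a nondegenerate alternating bilinear pairing
`Λ × Λ → ℤ` with values in the constant sheaf `ℤ`. -/
structure SymplecticForm (Λ : LatticeSheaf E F V n) where
  /-- The pairing on the stalk at `q`. -/
  form : ∀ q : M, Λ.stalk q →+ Λ.stalk q →+ ℤ
  locally_const : ∀ (U : TopologicalSpace.Opens M) (s t : Λ.sec U),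
    IsLocallyConstant fun x : U => form x (Λ.germ s x) (Λ.germ t x)
  alternating : ∀ q v, form q v v = 0
  nondegenerate : ∀ q v, (∀ w, form q v w = 0) → v = 0

/-- `w ∈ Λ_q` is the result of transporting `v ∈ Λ_p` along the path `γ` in the locally constant
sheaf `Λ`: there is a family of elements of the stalks `Λ_(γ t)` which starts at `v`, ends at `w`, and
is locally given by sections of `Λ`. -/
def IsTransport (Λ : LatticeSheaf E F V n) {p q : M} (γ : Path p q)
    (v : Λ.stalk p) (w : Λ.stalk q) : Prop :=
  ∃ c : unitInterval → TotalSpace F V,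
    (∀ t₀ : unitInterval, ∃ (U : TopologicalSpace.Opens M) (s : Λ.sec U), ∀ᶠ t in 𝓝 t₀,
      ∃ ht : γ t ∈ U, c t = ⟨γ t, s.1 ⟨γ t, ht⟩⟩) ∧
    c 0 = ⟨p, v⟩ ∧ c 1 = ⟨q, w⟩

/-- The endomorphism `T` of `Λ_p` is in the image of the monodromy representation
`π₁(M, p) → Aut Λ_p`: it is the transport along some loop at `p`. -/
def IsMonodromy (Λ : LatticeSheaf E F V n) {p : M} (T : Λ.stalk p →+ Λ.stalk p) : Prop :=
  ∃ γ : Path p p, ∀ v, Λ.IsTransport γ v (T v)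

/-- The transvection `v ↦ v + ⟨v, d⟩ d` of `Λ_p`. -/
def SymplecticForm.transvection {Λ : LatticeSheaf E F V n} (ψ : Λ.SymplecticForm) {p : M}
    (d : Λ.stalk p) : Λ.stalk p →+ Λ.stalk p where
  toFun v := v + ψ.form p v d • d
  map_zero' := by simp
  map_add' v w := by
    simp only [map_add, AddMonoidHom.add_apply, add_smul]
    abel

/-- `W` is the subbundle of `V` generated by `d ∈ Λ_p`: the smallest holomorphic subbundle that
contains the local section `d` of `Λ` and all its continuations along paths in `M`. -/
def IsSubbundleGeneratedBy (Λ : LatticeSheaf E F V n) {p : M} (d : Λ.stalk p)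
    (W : ∀ q, Submodule ℂ (V q)) : Prop :=
  IsLeast {W' : ∀ q, Submodule ℂ (V q) | IsHolomorphicSubbundle E F V W' ∧
    ∀ (q : M) (γ : Path p q) (w : Λ.stalk q), Λ.IsTransport γ d w → (w : V q) ∈ W' q} W

/-- The restriction of `f` to every fibre `V q` is invariant under translation by `Λ_q`. -/
def IsPeriodic (Λ : LatticeSheaf E F V n) (f : TotalSpace F V → ℂ) : Prop :=
  ∀ (q : M) (v : V q) (l : Λ.stalk q),
    (⟨q, v⟩ : TotalSpace F V) ∈ regularLocus (𝓘(ℂ, E).prod 𝓘(ℂ, F)) f →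
    (⟨q, v + l⟩ : TotalSpace F V) ∈ regularLocus (𝓘(ℂ, E).prod 𝓘(ℂ, F)) f →
    f ⟨q, v + l⟩ = f ⟨q, v⟩

end LatticeSheaf

section Good

variable (E : Type*) [NormedAddCommGroup E] [NormedSpace ℂ E]
  {F : Type*} [NormedAddCommGroup F] [NormedSpace ℂ F]
  {M : Type*} [TopologicalSpace M] [ChartedSpace E M]
  {V : M → Type*} [∀ x, AddCommGroup (V x)] [∀ x, Module ℂ (V x)]
  [TopologicalSpace (TotalSpace F V)] [∀ x, TopologicalSpace (V x)]
  [FiberBundle F V]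

/-- `f` is constant on all the cosets of `W q` in `V q`, for every `q`
(values are compared at points where `f` is holomorphic). -/
def IsConstantOnCosets (f : TotalSpace F V → ℂ) (W : ∀ q, Submodule ℂ (V q)) : Prop :=
  ∀ (q : M) (v v' : V q), v' - v ∈ W q →
    (⟨q, v⟩ : TotalSpace F V) ∈ regularLocus (𝓘(ℂ, E).prod 𝓘(ℂ, F)) f →
    (⟨q, v'⟩ : TotalSpace F V) ∈ regularLocus (𝓘(ℂ, E).prod 𝓘(ℂ, F)) f →
    f ⟨q, v⟩ = f ⟨q, v'⟩

variable {E}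

/-- The subbundle `W` is good: `f` is constant on all the cosets of the fibres `W q`, and the
elements of `Λ_q ∩ W q` span `W q` over the complex numbers. -/
def LatticeSheaf.IsGood {n : ℕ} (Λ : LatticeSheaf E F V n) (f : TotalSpace F V → ℂ)
    (W : ∀ q, Submodule ℂ (V q)) : Prop :=
  IsHolomorphicSubbundle E F V W ∧ IsConstantOnCosets E f W ∧
    ∀ q, Submodule.span ℂ ((Λ.stalk q : Set (V q)) ∩ W q) = W q

end Good

/-! On a fibre where the points of holomorphy are dense, the periods of `f` form a closed subgroup
`G` containing the lattice. Let `G₀` be the largest real subspace inside `G`. Projecting along `G₀`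
makes the lattice discrete, so the sublattice `L` of lattice vectors in `G₀` has rank `dim_ℝ G₀`
(`finrank_comap_of_forall_line`).

By Baire's theorem the fibre can be chosen generic: if all real multiples of a lattice vector are
periods there, they are periods over the whole chart (`exists_generic_fibre`). The identity theorem
continues this last condition along paths (`IsTransport.isInvariantGerm`), so `L` is stable under
monodromy, in particular under the transvections `T_i`. It is saturated, and it contains `δ` because
`f` is constant on the cosets of `W`. Holomorphy in the multiplier turns real multiples into complex
ones, so `G₀` contains the complex span `U` of `L`, and `rank L ≥ 2 dim_ℂ U`
(`exists_fibre_finrank_le`).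

The rest is linear algebra (`mem_of_transvection_stable`). If `δ_i ∉ L`, stability and saturation
force `δ_i ⟂ L`. Let `S` be the set of `i` with `δ_i ∈ L`. Pairing `L` with the `δ_i`, `i ∈ S`, has
as kernel the vectors of `L` orthogonal to every `δ_j`. These lie in the rational span of the
Lagrangian family `δ`, so independent ones stay independent over `ℂ`, and the kernel has rank at
most `dim U`. Hence `2 dim U ≤ |S| + dim U`, so `U` is spanned by the `δ_i` with `i ∈ S`. As `δ ∈ U`
has only nonzero coordinates, every `δ_i` is in `L`. All vectors are then periods on generic fibres,
by continuity on all fibres near `p`, and by the identity theorem on all fibres. -/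

/-! ### Meromorphic functions of several variables -/

section MeromorphicNear

variable {E : Type*} [NormedAddCommGroup E] [NormedSpace ℂ E]
  {F : Type*} [NormedAddCommGroup F] [NormedSpace ℂ F]

/-- `f` is a quotient of analytic functions near `x`. -/
def IsMeromorphicNear (f : E → ℂ) (x : E) : Prop :=
  ∃ g h : E → ℂ, AnalyticAt ℂ g x ∧ AnalyticAt ℂ h x ∧ (∃ᶠ z in 𝓝 x, h z ≠ 0) ∧
    ∀ᶠ y in 𝓝 x, h y ≠ 0 → f y = g y / h y

theorem frequently_ne_zero_of_analyticOnNhd {h : E → ℂ} {U : Set E} (hUo : IsOpen U)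
    (hU : IsPreconnected U) (hh : AnalyticOnNhd ℂ h U) {x : E} (hx : x ∈ U)
    (hne : ∃ᶠ z in 𝓝 x, h z ≠ 0) : ∀ y ∈ U, ∃ᶠ z in 𝓝 y, h z ≠ 0 := by
  intro y hy hcon
  have h0 : h =ᶠ[𝓝 y] 0 := hcon.mono fun z hz => by simpa using hz
  have hz := hh.eqOn_zero_of_preconnected_of_eventuallyEq_zero hU hy h0
  exact hne (Filter.eventually_of_mem (hUo.mem_nhds hx) fun z hzU => by simpa using hz hzU)

/-- A ball is connected, so by the identity theorem a denominator that does not vanish identically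
near the centre does not vanish identically near any other point either. -/
theorem IsMeromorphicNear.exists_ball {f : E → ℂ} {x : E} (hf : IsMeromorphicNear f x) :
    ∃ r > 0, ∃ g h : E → ℂ, AnalyticOnNhd ℂ g (Metric.ball x r) ∧
      AnalyticOnNhd ℂ h (Metric.ball x r) ∧
      (∀ y ∈ Metric.ball x r, ∃ᶠ z in 𝓝 y, h z ≠ 0) ∧
      ∀ y ∈ Metric.ball x r, h y ≠ 0 → f y = g y / h y := by
  obtain ⟨g, h, hg, hh, hne, heq⟩ := hf
  obtain ⟨r, hr, hb⟩ := Metric.eventually_nhds_iff_ball.1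
    (hg.eventually_analyticAt.and (hh.eventually_analyticAt.and heq))
  have hhb : AnalyticOnNhd ℂ h (Metric.ball x r) := fun y hy => (hb y hy).2.1
  exact ⟨r, hr, g, h, fun y hy => (hb y hy).1, hhb,
    frequently_ne_zero_of_analyticOnNhd Metric.isOpen_ball (convex_ball x r).isPreconnected hhb
      (Metric.mem_ball_self hr) hne, fun y hy => (hb y hy).2.2⟩

theorem analyticAt_of_eq_div {f g h : E → ℂ} {U : Set E} (hU : IsOpen U)
    (hg : AnalyticOnNhd ℂ g U) (hh : AnalyticOnNhd ℂ h U)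
    (heq : ∀ y ∈ U, h y ≠ 0 → f y = g y / h y) {y : E} (hy : y ∈ U) (hne : h y ≠ 0) :
    AnalyticAt ℂ f y := by
  refine ((hg y hy).div (hh y hy) hne).congr ?_
  filter_upwards [hU.mem_nhds hy, (hh y hy).continuousAt.eventually_ne hne] with z hz hz'
  exact (heq z hz hz').symm

theorem IsMeromorphicNear.frequently_analyticAt {f : E → ℂ} {x : E}
    (hf : IsMeromorphicNear f x) : ∃ᶠ z in 𝓝 x, AnalyticAt ℂ f z := by
  obtain ⟨r, hr, g, h, hg, hh, hne, heq⟩ := hf.exists_ball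
  refine ((hne x (Metric.mem_ball_self hr)).and_eventually (Metric.ball_mem_nhds x hr)).mono ?_
  rintro z ⟨hz, hzb⟩
  exact analyticAt_of_eq_div Metric.isOpen_ball hg hh heq hzb hz

/-- The identity theorem for meromorphic functions on a connected set. -/
theorem IsMeromorphicNear.eq_of_eventually_eq {f₁ f₂ : E → ℂ} {Ω : Set E}
    (hΩ : IsPreconnected Ω) (h₁ : ∀ x ∈ Ω, IsMeromorphicNear f₁ x)
    (h₂ : ∀ x ∈ Ω, IsMeromorphicNear f₂ x) {x₀ : E} (hx₀ : x₀ ∈ Ω)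
    (h : ∀ᶠ z in 𝓝 x₀, AnalyticAt ℂ f₁ z → AnalyticAt ℂ f₂ z → f₁ z = f₂ z) :
    ∀ z ∈ Ω, AnalyticAt ℂ f₁ z → AnalyticAt ℂ f₂ z → f₁ z = f₂ z := by
  suffices hs : Ω ⊆ {x | ∀ᶠ z in 𝓝 x, AnalyticAt ℂ f₁ z → AnalyticAt ℂ f₂ z → f₁ z = f₂ z} by
    intro z hz
    exact (hs hz).self_of_nhds
  refine hΩ.subset_of_closure_inter_subset isOpen_setOfPred_eventually_nhds ⟨x₀, hx₀, h⟩ ?_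
  rintro x ⟨hxc, hx⟩
  obtain ⟨r₁, hr₁, g₁, k₁, hg₁, hk₁, hne₁, heq₁⟩ := (h₁ x hx).exists_ball
  obtain ⟨r₂, hr₂, g₂, k₂, hg₂, hk₂, hne₂, heq₂⟩ := (h₂ x hx).exists_ball
  set r := min r₁ r₂ with hr
  have hrpos : 0 < r := lt_min hr₁ hr₂
  have hb₁ : Metric.ball x r ⊆ Metric.ball x r₁ := Metric.ball_subset_ball (min_le_left _ _)
  have hb₂ : Metric.ball x r ⊆ Metric.ball x r₂ := Metric.ball_subset_ball (min_le_right _ _)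
  obtain ⟨y, hy, hyr⟩ := Metric.mem_closure_iff.1 hxc r hrpos
  have hyb : y ∈ Metric.ball x r := Metric.mem_ball'.2 hyr
  -- The extra factor `k₁ * k₂` makes `Φ` vanish wherever a denominator does, so nothing has to be
  -- known about `f₁` and `f₂` there.
  let Φ : E → ℂ := fun z => (g₁ z * k₂ z - g₂ z * k₁ z) * (k₁ z * k₂ z)
  have hΦ : AnalyticOnNhd ℂ Φ (Metric.ball x r) := fun z hz =>
    (((hg₁ z (hb₁ hz)).mul (hk₂ z (hb₂ hz))).sub ((hg₂ z (hb₂ hz)).mul (hk₁ z (hb₁ hz)))).mul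
      ((hk₁ z (hb₁ hz)).mul (hk₂ z (hb₂ hz)))
  have hΦ0 : Φ =ᶠ[𝓝 y] 0 := by
    filter_upwards [hy, Metric.isOpen_ball.mem_nhds hyb] with z hz hzb
    by_cases hz1 : k₁ z = 0
    · simp [Φ, hz1]
    by_cases hz2 : k₂ z = 0
    · simp [Φ, hz2]
    have := hz (analyticAt_of_eq_div Metric.isOpen_ball hg₁ hk₁ heq₁ (hb₁ hzb) hz1)
      (analyticAt_of_eq_div Metric.isOpen_ball hg₂ hk₂ heq₂ (hb₂ hzb) hz2)
    rw [heq₁ z (hb₁ hzb) hz1, heq₂ z (hb₂ hzb) hz2, div_eq_div_iff hz1 hz2] at this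
    simp [Φ, this]
  have hzero := hΦ.eqOn_zero_of_preconnected_of_eventuallyEq_zero
    (convex_ball x r).isPreconnected hyb hΦ0
  filter_upwards [Metric.ball_mem_nhds x hrpos] with z hzb ha₁ ha₂
  -- Both functions may be analytic at a common zero of numerator and denominator. A strict
  -- inequality at `z` would persist nearby, hence at some `u` where neither denominator vanishes,
  -- against `Φ u = 0`.
  by_contra hcon
  have hev : ∀ᶠ w in 𝓝 z, f₁ w ≠ f₂ w ∧ w ∈ Metric.ball x r :=
    (ha₁.continuousAt.ne_iff_eventually_ne ha₂.continuousAt |>.1 hcon).and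
      (Metric.isOpen_ball.mem_nhds hzb)
  obtain ⟨w, hw1, hw⟩ := ((hne₁ z (hb₁ hzb)).and_eventually hev.eventually_nhds).exists
  have hwb := hw.self_of_nhds.2
  obtain ⟨u, hu2, hu1, hu⟩ := ((hne₂ w (hb₂ hwb)).and_eventually
    (((hk₁ w (hb₁ hwb)).continuousAt.eventually_ne hw1).and hw)).exists
  apply hu.1
  have := hzero hu.2
  simp only [Φ, Pi.zero_apply, mul_eq_zero, hu1, hu2, or_self, or_false, sub_eq_zero] at this
  rw [heq₁ u (hb₁ hu.2) hu1, heq₂ u (hb₂ hu.2) hu2, div_eq_div_iff hu1 hu2, this]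

/-- Fibrewise translation by `σ`. -/
def fibreShift {X G : Type*} [AddGroup G] (σ : X → G) (z : X × G) : X × G := (z.1, z.2 + σ z.1)

theorem fibreShift_neg_comp {X G : Type*} [AddGroup G] (σ : X → G) :
    fibreShift σ ∘ fibreShift (-σ) = id := by
  ext z <;> simp [fibreShift]

theorem fibreShift_comp_neg {X G : Type*} [AddGroup G] (σ : X → G) :
    fibreShift (-σ) ∘ fibreShift σ = id := by
  ext z <;> simp [fibreShift]

theorem analyticAt_fibreShift {σ : E → F} {z : E × F} (hσ : AnalyticAt ℂ σ z.1) :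
    AnalyticAt ℂ (fibreShift σ) z :=
  analyticAt_fst.prod (analyticAt_snd.add (AnalyticAt.comp hσ analyticAt_fst))

theorem AnalyticAt.comp_fibreShift {f : E × F → ℂ} {σ : E → F} {z : E × F}
    (hσ : AnalyticAt ℂ σ z.1) (hf : AnalyticAt ℂ f (fibreShift σ z)) :
    AnalyticAt ℂ (f ∘ fibreShift σ) z :=
  AnalyticAt.comp hf (analyticAt_fibreShift hσ)

theorem analyticAt_comp_fibreShift_iff {f : E × F → ℂ} {σ : E → F} {z : E × F}
    (hσ : AnalyticAt ℂ σ z.1) :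
    AnalyticAt ℂ (f ∘ fibreShift σ) z ↔ AnalyticAt ℂ f (fibreShift σ z) := by
  refine ⟨fun h => ?_, AnalyticAt.comp_fibreShift hσ⟩
  have h0 : fibreShift (-σ) (fibreShift σ z) = z := congrFun (fibreShift_comp_neg σ) z
  have := AnalyticAt.comp_fibreShift (f := f ∘ fibreShift σ) (σ := -σ) (z := fibreShift σ z)
    (hσ.neg) (by rwa [h0])
  rwa [Function.comp_assoc, fibreShift_neg_comp, Function.comp_id] at this

theorem IsMeromorphicNear.comp_fibreShift {f : E × F → ℂ} {σ : E → F} {z : E × F}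
    (hσ : AnalyticAt ℂ σ z.1) (hf : IsMeromorphicNear f (fibreShift σ z)) :
    IsMeromorphicNear (f ∘ fibreShift σ) z := by
  obtain ⟨g, h, hg, hh, hne, heq⟩ := hf
  have hc := (analyticAt_fibreShift hσ).continuousAt
  have h0 : fibreShift (-σ) (fibreShift σ z) = z := congrFun (fibreShift_comp_neg σ) z
  have hc' : Tendsto (fibreShift (-σ)) (𝓝 (fibreShift σ z)) (𝓝 z) := by
    have := (analyticAt_fibreShift (σ := -σ) (z := fibreShift σ z) hσ.neg).continuousAt
    rwa [ContinuousAt, h0] at this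
  refine ⟨g ∘ fibreShift σ, h ∘ fibreShift σ, hσ.comp_fibreShift hg, hσ.comp_fibreShift hh, ?_,
    hc.eventually heq⟩
  refine hc'.frequently (hne.mono fun w hw => ?_)
  have : fibreShift σ (fibreShift (-σ) w) = w := congrFun (fibreShift_neg_comp σ) w
  simpa [this] using hw

/-- `f` is invariant under fibrewise translation by `σ` over `B`; values are compared at points where
`f` is analytic. -/
def IsInvariantOver (f : E × F → ℂ) (B : Set E) (σ : E → F) : Prop :=
  ∀ y ∈ B, ∀ w, AnalyticAt ℂ f (y, w) → AnalyticAt ℂ f (y, w + σ y) → f (y, w + σ y) = f (y, w)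

/-- The identity theorem on the connected set `B × F`, applied to `f` and its translate, which is
again meromorphic. This is the tool behind every propagation of periods below. -/
theorem IsInvariantOver.of_eventually [CompleteSpace F] {f : E × F → ℂ} {B : Set E} {σ : E → F}
    (hB : IsPreconnected B) (hf : ∀ y ∈ B, ∀ w, IsMeromorphicNear f (y, w))
    (hσ : AnalyticOnNhd ℂ σ B) {z : E × F} (hz : z.1 ∈ B)
    (h : ∀ᶠ u in 𝓝 z, AnalyticAt ℂ f u → AnalyticAt ℂ f (fibreShift σ u) →
      f (fibreShift σ u) = f u) : IsInvariantOver f B σ := by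
  have hσ' : ∀ᶠ u : E × F in 𝓝 z, AnalyticAt ℂ σ u.1 :=
    continuous_fst.continuousAt.eventually (hσ z.1 hz).eventually_analyticAt
  have key := IsMeromorphicNear.eq_of_eventually_eq (f₁ := f ∘ fibreShift σ) (f₂ := f)
    (hB.prod (isPreconnected_univ (α := F)))
    (fun x hx => (hf _ hx.1 _).comp_fibreShift (hσ _ hx.1))
    (fun x hx => hf _ hx.1 _) (x₀ := z) ⟨hz, mem_univ _⟩ (by
      filter_upwards [h, hσ'] with u hu hu' h1 h2
      exact hu h2 ((analyticAt_comp_fibreShift_iff hu').1 h1))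
  intro y hy w h1 h2
  exact key (y, w) ⟨hy, mem_univ _⟩ ((analyticAt_comp_fibreShift_iff (hσ y hy)).2 h2) h1

theorem IsInvariantOver.of_isOpen [CompleteSpace F] {f : E × F → ℂ} {B B' : Set E} {σ : E → F}
    (hB : IsPreconnected B) (hf : ∀ y ∈ B, ∀ w, IsMeromorphicNear f (y, w))
    (hσ : AnalyticOnNhd ℂ σ B) (hB' : IsOpen B') (hne : (B ∩ B').Nonempty)
    (h : IsInvariantOver f B' σ) : IsInvariantOver f B σ := by
  obtain ⟨y, hy, hy'⟩ := hne
  refine .of_eventually hB hf hσ (z := (y, 0)) hy ?_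
  filter_upwards [continuous_fst.continuousAt.preimage_mem_nhds (hB'.mem_nhds hy')] with u hu h1 h2
  exact h u.1 hu u.2 h1 h2

end MeromorphicNear

theorem LinearMap.finrank_range_add_finrank_ker_int {A B : Type*} [AddCommGroup A]
    [Module.Finite ℤ A] [AddCommGroup B] (g : A →ₗ[ℤ] B) :
    Module.finrank ℤ (LinearMap.range g) + Module.finrank ℤ (LinearMap.ker g) =
      Module.finrank ℤ A := by
  rw [← g.quotKerEquivRange.finrank_eq, Submodule.finrank_quotient_add_finrank]

/-! ### Closed subgroups of real vector spaces -/

section ClosedSubgroup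

open Module

/-- If `H` is not discrete, it has nonzero elements `h k → 0` whose directions accumulate at a unit
vector `u`. The integer multiples `⌊t / ‖h k‖⌋ • h k` then tend to `t • u` along a subsequence, so
the closed group `H` contains the line through `u`. -/
theorem discreteTopology_of_isClosed_of_forall_line {K : Type*} [NormedAddCommGroup K]
    [NormedSpace ℝ K] [FiniteDimensional ℝ K] (H : AddSubgroup K) (hc : IsClosed (H : Set K))
    (hl : ∀ v, (∀ t : ℝ, t • v ∈ H) → v = 0) : DiscreteTopology H := by
  rw [discreteTopology_iff_isOpen_singleton_zero, Metric.isOpen_singleton_iff]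
  by_contra! hcon
  have hseq : ∀ k : ℕ, ∃ h ∈ H, h ≠ 0 ∧ ‖h‖ < 1 / ((k : ℝ) + 1) := fun k => by
    obtain ⟨y, hy, hy0⟩ := hcon (1 / ((k : ℝ) + 1)) (by positivity)
    refine ⟨y, y.2, fun h => hy0 (Subtype.ext h), ?_⟩
    simpa [Subtype.dist_eq] using hy
  choose h hH h0 hlt using hseq
  have hnorm : Tendsto (fun k => ‖h k‖) atTop (𝓝 0) :=
    squeeze_zero (fun k => norm_nonneg (h k)) (fun k => (hlt k).le)
      (tendsto_one_div_add_atTop_nhds_zero_nat (𝕜 := ℝ))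
  obtain ⟨u, hu, φ, hφ, hlim⟩ := (isCompact_sphere (0 : K) 1).tendsto_subseq
    (x := fun k => ‖h k‖⁻¹ • h k) (fun k => by
      simp [norm_smul, inv_mul_cancel₀ (norm_ne_zero_iff.2 (h0 k))])
  have : u = 0 := hl u fun t => by
    have hmem : ∀ k, (⌊t / ‖h (φ k)‖⌋ : ℤ) • h (φ k) ∈ H := fun k => H.zsmul_mem (hH _) _
    refine hc.mem_of_tendsto (b := atTop) (f := fun k => (⌊t / ‖h (φ k)‖⌋ : ℤ) • h (φ k)) ?_
      (Eventually.of_forall hmem)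
    have hr : Tendsto (fun k => (⌊t / ‖h (φ k)‖⌋ : ℝ) * ‖h (φ k)‖) atTop (𝓝 t) := by
      have hn' := hnorm.comp hφ.tendsto_atTop
      rw [tendsto_iff_dist_tendsto_zero]
      refine squeeze_zero (fun _ => dist_nonneg) (fun k => ?_) hn'
      have hp : 0 < ‖h (φ k)‖ := norm_pos_iff.2 (h0 _)
      have h1 := Int.floor_le (t / ‖h (φ k)‖)
      have h2 := (Int.lt_floor_add_one (t / ‖h (φ k)‖)).le
      rw [le_div_iff₀ hp] at h1
      rw [div_le_iff₀ hp] at h2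
      simp only [Function.comp, Real.dist_eq, abs_le]
      constructor <;> linarith
    refine (hr.smul hlim).congr fun k => ?_
    have hp : ‖h (φ k)‖ ≠ 0 := norm_ne_zero_iff.2 (h0 _)
    simp only [Function.comp, smul_smul, mul_assoc, mul_inv_cancel₀ hp, mul_one]
    exact Int.cast_smul_eq_zsmul ℝ _ _
  simp [this] at hu

/-- If a closed subgroup `G` contains a lattice, the lattice vectors in the largest
linear subspace `G₀` of `G` have rank `dim G₀`. -/
theorem finrank_comap_of_forall_line {Z : Type*} [AddCommGroup Z] [Module.Free ℤ Z]
    [Module.Finite ℤ Z] {F : Type*} [NormedAddCommGroup F] [NormedSpace ℝ F]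
    [FiniteDimensional ℝ F] (ev : Z →ₗ[ℤ] F) (hspan : Submodule.span ℝ (range ev) = ⊤)
    (hrank : finrank ℤ Z = finrank ℝ F) (G : AddSubgroup F) (hG : IsClosed (G : Set F))
    (hev : ∀ c, ev c ∈ G) (G₀ : Submodule ℝ F) (hG₀ : ∀ v, v ∈ G₀ ↔ ∀ t : ℝ, t • v ∈ G) :
    finrank ℤ ((G₀.restrictScalars ℤ).comap ev) = finrank ℝ G₀ := by
  obtain ⟨K, hK⟩ := Submodule.exists_isCompl G₀
  let pr : F →ₗ[ℝ] K := Submodule.projectionOnto K G₀ hK.symm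
  have hle : ∀ v ∈ G₀, v ∈ G := fun v hv => by simpa using (hG₀ v).1 hv 1
  have hpr : ∀ v, v - pr v ∈ G₀ := fun v => by
    rw [← Submodule.ker_projectionOnto hK.symm, LinearMap.mem_ker, map_sub, sub_eq_zero]
    exact (Submodule.projectionOnto_apply_left hK.symm (pr v)).symm
  -- `G ∩ K` contains no line, since such a line would lie in `G₀`; hence it is discrete. It
  -- contains the projected lattice because `G₀ ⊆ G`. So that projection is a lattice in `K`, and
  -- rank-nullity gives the rank of its kernel.
  let H : AddSubgroup K := G.comap K.subtype.toAddMonoidHom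
  have hHc : IsClosed (H : Set K) := hG.preimage continuous_subtype_val
  have hHd : DiscreteTopology H := discreteTopology_of_isClosed_of_forall_line H hHc fun v hv => by
    have h1 : (v : F) ∈ G₀ := (hG₀ v).2 fun t => hv t
    exact Subtype.ext ((Submodule.disjoint_def.1 hK.disjoint) v h1 v.2)
  let g : Z →ₗ[ℤ] K := (pr.restrictScalars ℤ).comp ev
  let Λ : Submodule ℤ K := LinearMap.range g
  have hΛH : (Λ : Set K) ⊆ H := by
    rintro _ ⟨c, rfl⟩
    have : ev c - (ev c - pr (ev c)) ∈ G := G.sub_mem (hev c) (hle _ (hpr _))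
    simpa [H, g] using this
  have : DiscreteTopology Λ := DiscreteTopology.of_subset (s := (H : Set K)) hHd hΛH
  have : IsZLattice ℝ Λ := ⟨by
    have h1 : (Λ : Set K) = pr '' range ev := by
      rw [← range_comp]; rfl
    rw [h1, ← Submodule.map_span, hspan, Submodule.map_top, Submodule.range_projectionOnto]⟩
  have h1 := ZLattice.rank ℝ Λ
  have h2 := LinearMap.finrank_range_add_finrank_ker_int g
  have h3 := Submodule.finrank_add_eq_of_isCompl hK
  have h4 : LinearMap.ker g = (G₀.restrictScalars ℤ).comap ev := by
    ext c
    simp only [LinearMap.mem_ker, Submodule.mem_comap, Submodule.restrictScalars_mem]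
    change pr (ev c) = 0 ↔ _
    rw [← LinearMap.mem_ker, Submodule.ker_projectionOnto]
  rw [h4] at h2
  change finrank ℤ Λ + _ = _ at h2
  omega

end ClosedSubgroup

/-! ### Sublattices stable under transvections -/

section Transvection

open Module

variable {n : ℕ} {Z : Type*} [AddCommGroup Z] [Module.Finite ℤ Z]
  {F : Type*} [AddCommGroup F] [Module ℂ F] [FiniteDimensional ℂ F]

/-- An isotropic family of half the rank is rationally its own orthogonal. A relation among the
functionals `ψ · (d i)` would put a combination of the `d i` in the radical, so pairing with `d` has
rank at least `n` and its kernel has rank at most `n`. This kernel already contains the `n`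
independent vectors `d i`, leaving no room for an independent `x`. -/
theorem exists_smul_mem_span_of_isotropic (hZ : finrank ℤ Z = 2 * n) (ψ : Z →ₗ[ℤ] Z →ₗ[ℤ] ℤ)
    (halt : ∀ v, ψ v v = 0) (hnd : ∀ v, (∀ w, ψ v w = 0) → v = 0) (d : Fin n → Z)
    (hd : LinearIndependent ℤ d) (hiso : ∀ i j, ψ (d i) (d j) = 0) (x : Z)
    (hx : ∀ i, ψ x (d i) = 0) : ∃ m : ℤ, m ≠ 0 ∧ m • x ∈ Submodule.span ℤ (range d) := by
  have hsymm : ∀ v w, ψ v w = - ψ w v := fun v w => by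
    have := halt (v + w)
    simp only [map_add, LinearMap.add_apply, halt, zero_add, add_zero] at this
    linarith
  let Φ : Z →ₗ[ℤ] (Fin n → ℤ) := LinearMap.pi fun i => ψ.flip (d i)
  have hΦ : ∀ z i, Φ z i = ψ z (d i) := fun z i => rfl
  let R := LinearMap.range Φ
  let Θ : (Fin n → ℤ) →ₗ[ℤ] Module.Dual ℤ R :=
    (Module.Dual.transpose R.subtype).comp (Fintype.linearCombination ℤ
      fun i => (LinearMap.proj i : (Fin n → ℤ) →ₗ[ℤ] ℤ))
  have hΘ : Function.Injective Θ := by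
    rw [← LinearMap.ker_eq_bot, LinearMap.ker_eq_bot']
    intro a ha
    have h0 : ∑ i, a i • d i = 0 := hnd _ fun w => by
      rw [hsymm, neg_eq_zero]
      have := LinearMap.congr_fun ha ⟨Φ w, w, rfl⟩
      simpa [Θ, Fintype.linearCombination_apply, Module.Dual.transpose, hΦ] using this
    exact funext (Fintype.linearIndependent_iff.1 hd a h0)
  have h1 : n ≤ finrank ℤ R := by
    have := LinearMap.finrank_le_finrank_of_injective hΘ
    rwa [Module.finrank_linearMap_self, Module.finrank_fin_fun] at this
  have h2 := LinearMap.finrank_range_add_finrank_ker_int Φ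
  change finrank ℤ R + _ = _ at h2
  by_contra! hcon
  let d' : Fin n → LinearMap.ker Φ := fun i => ⟨d i, by ext j; simpa [hΦ] using hiso i j⟩
  let x' : LinearMap.ker Φ := ⟨x, by ext j; simpa [hΦ] using hx j⟩
  have hd' : LinearIndependent ℤ d' := LinearIndependent.of_comp (LinearMap.ker Φ).subtype hd
  have hli : LinearIndependent ℤ (Fin.cons x' d' : Fin (n + 1) → LinearMap.ker Φ) := by
    refine hd'.finCons' _ _ fun c y hys hy => ?_
    by_contra hc
    refine hcon c hc ?_
    have hy' : c • x' = - y := eq_neg_of_add_eq_zero_left hy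
    have h3 : c • x = (LinearMap.ker Φ).subtype (-y) := by rw [← hy']; rfl
    have h4 : range d = (LinearMap.ker Φ).subtype '' range d' := by
      rw [← range_comp]; rfl
    rw [h3, h4, ← Submodule.map_span]
    exact Submodule.mem_map_of_mem (Submodule.neg_mem _ hys)
  have := hli.fintype_card_le_finrank
  rw [Fintype.card_fin] at this
  omega

/-- Lattice vectors independent over `ℤ` are in general dependent over `ℂ`. Here, after clearing
denominators, their coordinates in the complex-independent family `d` are integer vectors, whose
independence passes from `ℤ` to `ℂ`. -/
theorem linearIndependent_complex_of_smul_mem_span {n : ℕ} {Z F : Type*} [AddCommGroup Z]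
    [AddCommGroup F] [Module ℂ F] {ι : Type*} [Finite ι] (ev : Z →ₗ[ℤ] F)
    (d : Fin n → Z) (hd : LinearIndependent ℂ (ev ∘ d)) (b : ι → Z) (hb : LinearIndependent ℤ b)
    (h : ∀ j, ∃ m : ℤ, m ≠ 0 ∧ m • b j ∈ Submodule.span ℤ (range d)) :
    LinearIndependent ℂ (ev ∘ b) := by
  cases nonempty_fintype ι
  choose m hm hmem using h
  set N : ℤ := ∏ j, m j with hN
  have hN0 : N ≠ 0 := Finset.prod_ne_zero_iff.2 fun j _ => hm j
  have hA : ∀ j, ∃ a : Fin n → ℤ, ∑ i, a i • d i = N • b j := fun j => by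
    rw [← Submodule.mem_span_range_iff_exists_fun]
    obtain ⟨c, hc⟩ := Finset.dvd_prod_of_mem m (Finset.mem_univ j)
    rw [hN, hc, mul_comm, mul_smul]
    exact Submodule.smul_mem _ _ (hmem j)
  choose A hA using hA
  have hAi : LinearIndependent ℤ A := by
    rw [Fintype.linearIndependent_iff] at hb ⊢
    intro t ht
    have : ∑ j, (t j * N) • b j = 0 := by
      simp only [mul_smul, ← hA, Finset.smul_sum]
      rw [Finset.sum_comm]
      refine Finset.sum_eq_zero fun i _ => ?_
      have := congrFun ht i
      simp only [Finset.sum_apply, Pi.smul_apply, smul_eq_mul, Pi.zero_apply] at this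
      simp only [smul_smul]
      rw [← Finset.sum_smul, this, zero_smul]
    intro j
    simpa [hN0] using hb _ this j
  have hAC := (linearIndependent_algebraMap_comp_iff (S := ℂ)).2 hAi
  have hinj : LinearMap.ker (Fintype.linearCombination ℂ (ev ∘ d)) = ⊥ := by
    rw [LinearMap.ker_eq_bot']
    intro c hc
    exact funext (Fintype.linearIndependent_iff.1 hd c (by simpa [Fintype.linearCombination_apply] using hc))
  have := hAC.map' _ hinj
  refine LinearIndependent.of_comp ((N : ℂ) • LinearMap.id : F →ₗ[ℂ] F) ?_
  suffices hfun : ((N : ℂ) • LinearMap.id : F →ₗ[ℂ] F) ∘ ev ∘ b =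
      Fintype.linearCombination ℂ (ev ∘ d) ∘ fun i => algebraMap ℤ ℂ ∘ A i by
    rw [hfun]; exact this
  ext j
  have h1 := congrArg ev (hA j)
  simp only [map_sum, map_zsmul] at h1
  simp only [Function.comp, Fintype.linearCombination_apply, LinearMap.smul_apply, LinearMap.id_apply,
    algebraMap_int_eq, eq_intCast, Int.cast_smul_eq_zsmul]
  exact h1.symm

/-- A saturated sublattice `L` of a symplectic lattice, stable under the transvections along an
isotropic family `d` which is a complex basis, contains the family if it contains
`∑ i, (i + 1) • d i` and its rank is at least twice the complex dimension of its span. -/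
theorem mem_of_transvection_stable [Module.Free ℤ Z] (hZ : finrank ℤ Z = 2 * n) (hF : finrank ℂ F = n)
    (ψ : Z →ₗ[ℤ] Z →ₗ[ℤ] ℤ) (halt : ∀ v, ψ v v = 0) (hnd : ∀ v, (∀ w, ψ v w = 0) → v = 0)
    (ev : Z →ₗ[ℤ] F) (d : Fin n → Z) (hd : LinearIndependent ℂ (ev ∘ d))
    (hiso : ∀ i j, ψ (d i) (d j) = 0) (L : Submodule ℤ Z)
    (hsat : ∀ (m : ℤ) (x : Z), m ≠ 0 → m • x ∈ L → x ∈ L)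
    (hT : ∀ i, ∀ x ∈ L, x + ψ x (d i) • d i ∈ L)
    (hδ : ∑ i : Fin n, ((i : ℕ) + 1) • d i ∈ L)
    (hrank : 2 * finrank ℂ (Submodule.span ℂ (ev '' L)) ≤ finrank ℤ L) (i : Fin n) : d i ∈ L := by
  classical
  set U := Submodule.span ℂ (ev '' L) with hU
  have hdZ : LinearIndependent ℤ d :=
    LinearIndependent.of_comp ev (hd.restrict_scalars' ℤ)
  -- Subtracting `x` from its transvection leaves `ψ x (d i) • d i` in `L`; if the coefficient is
  -- nonzero, saturation gives `d i ∈ L`.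
  have hperp : ∀ i, d i ∉ L → ∀ x ∈ L, ψ x (d i) = 0 := fun i hi x hx => by
    by_contra hne
    refine hi (hsat _ _ hne ?_)
    simpa using L.sub_mem (hT i x hx) hx
  let S := {i // d i ∈ L}
  let Φ : L →ₗ[ℤ] (S → ℤ) := LinearMap.pi fun i => (ψ.flip (d i)).comp L.subtype
  -- By `hperp`, a vector of `L` orthogonal to the `d i` in `L` is orthogonal to all the `d i`.
  have hker : finrank ℤ (LinearMap.ker Φ) ≤ finrank ℂ U := by
    let b := Module.finBasis ℤ (LinearMap.ker Φ)
    let b' : Fin (finrank ℤ (LinearMap.ker Φ)) → Z := fun j => ((b j : L) : Z)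
    have hb' : LinearIndependent ℤ b' := by
      have := b.linearIndependent.map' (L.subtype.comp (LinearMap.ker Φ).subtype)
        (LinearMap.ker_eq_bot.2 (Subtype.val_injective.comp Subtype.val_injective))
      exact this
    have hli := linearIndependent_complex_of_smul_mem_span ev d hd b' hb' fun j =>
      exists_smul_mem_span_of_isotropic hZ ψ halt hnd d hdZ hiso _ fun i => by
        by_cases hi : d i ∈ L
        · exact congrFun (LinearMap.mem_ker.1 (b j).2) (⟨i, hi⟩ : S)
        · exact hperp i hi _ (b j : L).2
    have hmem : ∀ j, ev (b' j) ∈ U := fun j =>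
      Submodule.subset_span ⟨_, (b j : L).2, rfl⟩
    have hli' : LinearIndependent ℂ (fun j => (⟨ev (b' j), hmem j⟩ : U)) :=
      LinearIndependent.of_comp U.subtype hli
    simpa using hli'.fintype_card_le_finrank
  have hrn := LinearMap.finrank_range_add_finrank_ker_int Φ
  have hrange : finrank ℤ (LinearMap.range Φ) ≤ Fintype.card S := by
    simpa using Submodule.finrank_le (LinearMap.range Φ)
  have hcard : finrank ℂ U ≤ Fintype.card S := by omega
  have hSli : LinearIndependent ℂ (fun i : S => ev (d i)) := hd.comp _ Subtype.val_injective
  have hle : Submodule.span ℂ (range fun i : S => ev (d i)) ≤ U := by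
    rw [Submodule.span_le]
    rintro _ ⟨i, rfl⟩
    exact Submodule.subset_span ⟨_, i.2, rfl⟩
  have heq : Submodule.span ℂ (range fun i : S => ev (d i)) = U :=
    Submodule.eq_of_le_of_finrank_le hle (by rwa [finrank_span_eq_card hSli])
  have : Nonempty (Fin n) := ⟨i⟩
  let β := basisOfLinearIndependentOfCardEqFinrank hd (by simp [hF])
  have hβ : ⇑β = ev ∘ d := coe_basisOfLinearIndependentOfCardEqFinrank hd _
  have hmem : ev (∑ i : Fin n, ((i : ℕ) + 1) • d i) ∈ U := Submodule.subset_span ⟨_, hδ, rfl⟩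
  have hrg : (range fun i : S => ev (d i)) = β '' {i | d i ∈ L} := by
    rw [hβ]; ext v; simp [S]
  rw [← heq, hrg, β.mem_span_image] at hmem
  have hsum : ev (∑ i : Fin n, ((i : ℕ) + 1) • d i) = ∑ i : Fin n, ((i : ℂ) + 1) • β i := by
    rw [map_sum]
    refine Finset.sum_congr rfl fun j _ => ?_
    rw [hβ, map_nsmul, ← Nat.cast_smul_eq_nsmul ℂ]
    push_cast; rfl
  -- Membership in the span of the `d j ∈ L` confines the support of `δ` to those indices, and its
  -- coordinate at `i` is `i + 1 ≠ 0`.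
  refine hmem ?_
  rw [hsum, Finset.mem_coe, Finsupp.mem_support_iff, map_sum, Finsupp.finsetSum_apply]
  simp only [map_smul, Basis.repr_self, Finsupp.smul_single, Finsupp.single_apply, smul_eq_mul, mul_one]
  rw [Finset.sum_ite_eq' Finset.univ i]
  simpa using Nat.cast_add_one_ne_zero (R := ℂ) (i : ℕ)

end Transvection

/-! ### Periods of a meromorphic function on a generic fibre -/

section GenericFibre

open Module

theorem exists_mem_forall_mem_of_isOpen {X ι : Type*} [TopologicalSpace X] [BaireSpace X]
    [Countable ι] {B : Set X} (hB : IsOpen B) (hne : B.Nonempty) (D : ι → Set X)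
    (hD : ∀ j, IsOpen (D j)) (hBD : ∀ j, B ⊆ closure (D j)) : ∃ y ∈ B, ∀ j, y ∈ D j := by
  -- Adjoining the exterior of `B` makes each set dense in all of `X`, so that Baire's theorem
  -- applies there.
  have hdense : Dense (⋂ j, (D j ∪ (closure B)ᶜ)) := by
    refine dense_iInter_of_isOpen (fun j => (hD j).union isClosed_closure.isOpen_compl) fun j x => ?_
    by_cases hx : x ∈ closure B
    · exact closure_mono subset_union_left (closure_minimal (hBD j) isClosed_closure hx)
    · exact subset_closure (Or.inr hx)
  obtain ⟨y, hy, hyD⟩ := hdense.inter_open_nonempty B hB hne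
  refine ⟨y, hy, fun j => ?_⟩
  exact (mem_iInter.1 hyD j).resolve_right fun h => h (subset_closure hy)

variable {E : Type*} [NormedAddCommGroup E] [NormedSpace ℂ E]
  {F : Type*} [NormedAddCommGroup F] [NormedSpace ℂ F]

/-- The group of periods of the restriction of `f` to the fibre over `y`. -/
def fibrePeriods (f : E × F → ℂ) (y : E) (hd : Dense {w | AnalyticAt ℂ f (y, w)}) :
    AddSubgroup F where
  carrier := {v | ∀ w, AnalyticAt ℂ f (y, w) → AnalyticAt ℂ f (y, w + v) →
    f (y, w + v) = f (y, w)}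
  zero_mem' := fun w _ _ => by rw [add_zero]
  add_mem' := by
    intro a b ha hb w h1 h2
    by_contra hne
    have c1 : Tendsto (fun w' : F => (y, w')) (𝓝 w) (𝓝 (y, w)) :=
      (by fun_prop : Continuous fun w' : F => (y, w')).tendsto w
    have c2 : Tendsto (fun w' : F => (y, w' + (a + b))) (𝓝 w) (𝓝 (y, w + (a + b))) :=
      (by fun_prop : Continuous fun w' : F => (y, w' + (a + b))).tendsto w
    have e1 := ((h2.continuousAt.tendsto.comp c2).prodMk_nhds
      (h1.continuousAt.tendsto.comp c1)).eventually (isOpen_ne_fun continuous_fst continuous_snd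
        |>.mem_nhds hne)
    have e2 := c1.eventually h1.eventually_analyticAt
    have e3 := c2.eventually h2.eventually_analyticAt
    -- The intermediate point `w + a` may be a singularity. Density allows moving `w` slightly to
    -- avoid this while the assumed inequality persists.
    have hda : Dense ((fun w' => w' + a) ⁻¹' {w | AnalyticAt ℂ f (y, w)}) :=
      hd.preimage (Homeomorph.addRight a).isOpenMap
    obtain ⟨w', h3, h4, h5, h6⟩ := ((mem_closure_iff_frequently.1 (hda w)).and_eventually
      (e1.and (e2.and e3))).exists
    have h3' : AnalyticAt ℂ f (y, w' + a) := h3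
    rw [← add_assoc] at h6
    refine h4 ?_
    simp only [Function.comp, ← add_assoc]
    rw [hb _ h3' h6, ha _ h5 h3']
  neg_mem' := by
    intro a ha w h1 h2
    have := ha (w + -a) h2 (by simpa using h1)
    simpa using this.symm

theorem mem_fibrePeriods {f : E × F → ℂ} {y : E} {hd : Dense {w | AnalyticAt ℂ f (y, w)}} {v : F} :
    v ∈ fibrePeriods f y hd ↔ ∀ w, AnalyticAt ℂ f (y, w) → AnalyticAt ℂ f (y, w + v) →
      f (y, w + v) = f (y, w) := Iff.rfl

theorem isClosed_fibrePeriods (f : E × F → ℂ) (y : E)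
    (hd : Dense {w | AnalyticAt ℂ f (y, w)}) : IsClosed (fibrePeriods f y hd : Set F) := by
  rw [← isOpen_compl_iff, isOpen_iff_mem_nhds]
  intro v hv
  simp only [mem_compl_iff, SetLike.mem_coe, mem_fibrePeriods, not_forall] at hv
  obtain ⟨w, h1, h2, h3⟩ := hv
  have c : Tendsto (fun v' : F => (y, w + v')) (𝓝 v) (𝓝 (y, w + v)) :=
    (by fun_prop : Continuous fun v' : F => (y, w + v')).tendsto v
  filter_upwards [c.eventually h2.eventually_analyticAt,
    c.eventually (h2.continuousAt.eventually_ne h3)] with v' h4 h5 h6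
  exact h5 (h6 w h1 h4)

variable [FiniteDimensional ℂ E] [FiniteDimensional ℂ F]

/-- If invariance along the real multiples of `σ c` fails over `B`, the points `y` where a failure
is visible form an open set whose closure contains `B'`: otherwise invariance would hold over a
nonempty open set and spread to `B`. Letting `t` vary inside each set leaves countably many
conditions, one per `c`. Density of the analytic points costs one more per basic open set of `F`,
and Baire's theorem meets them all. -/
theorem exists_generic_fibre {f : E × F → ℂ} {B : Set E} (hBo : IsOpen B) (hB : IsPreconnected B)
    (hf : ∀ y ∈ B, ∀ w, IsMeromorphicNear f (y, w)) {Z : Type*} [Countable Z] (σ : Z → E → F)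
    (hσ : ∀ c, AnalyticOnNhd ℂ (σ c) B) {B' : Set E} (hB' : IsOpen B') (hBB' : B' ⊆ B)
    (hne : B'.Nonempty) :
    ∃ y ∈ B', Dense {w | AnalyticAt ℂ f (y, w)} ∧
      ∀ c, (∀ t : ℝ, ∀ w, AnalyticAt ℂ f (y, w) → AnalyticAt ℂ f (y, w + (t : ℂ) • σ c y) →
          f (y, w + (t : ℂ) • σ c y) = f (y, w)) →
        ∀ t : ℝ, IsInvariantOver f B fun y => (t : ℂ) • σ c y := by
  have : CompleteSpace E := FiniteDimensional.complete ℂ E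
  have : CompleteSpace F := FiniteDimensional.complete ℂ F
  have : ProperSpace F := FiniteDimensional.proper ℂ F
  let N : Set Z := {c | ¬ ∀ t : ℝ, IsInvariantOver f B fun y => (t : ℂ) • σ c y}
  let bs := {b : Set F // b ∈ TopologicalSpace.countableBasis F}
  have : Countable bs := (TopologicalSpace.countable_countableBasis F).to_subtype
  let D : N ⊕ bs → Set E := Sum.elim
    (fun c => {y | y ∈ B ∧ ∃ (t : ℝ) (w : F), AnalyticAt ℂ f (y, w) ∧
      AnalyticAt ℂ f (y, w + (t : ℂ) • σ c y) ∧ f (y, w + (t : ℂ) • σ c y) ≠ f (y, w)})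
    (fun b => Prod.fst '' ({z | AnalyticAt ℂ f z} ∩ Prod.snd ⁻¹' b.1))
  suffices hD : (∀ j, IsOpen (D j)) ∧ ∀ j, B' ⊆ closure (D j) by
    obtain ⟨y, hy, hyD⟩ := exists_mem_forall_mem_of_isOpen hB' hne D hD.1 hD.2
    refine ⟨y, hy, ?_, fun c hc => ?_⟩
    · refine (TopologicalSpace.isBasis_countableBasis F).dense_iff.2 fun o ho _ => ?_
      obtain ⟨⟨y', w⟩, ⟨h1, h2⟩, rfl⟩ := hyD (Sum.inr ⟨o, ho⟩)
      exact ⟨w, h2, h1⟩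
    · by_contra hcon
      obtain ⟨-, t, w, h1, h2, h3⟩ := hyD (Sum.inl ⟨c, hcon⟩)
      exact h3 (hc t w h1 h2)
  constructor
  · rintro (c | b)
    · refine isOpen_iff_mem_nhds.2 ?_
      rintro y ⟨hy, t, w, h1, h2, h3⟩
      have c1 : Tendsto (fun y' : E => (y', w)) (𝓝 y) (𝓝 (y, w)) :=
        (by fun_prop : Continuous fun y' : E => (y', w)).tendsto y
      have c2 : Tendsto (fun y' : E => (y', w + (t : ℂ) • σ c y')) (𝓝 y)
          (𝓝 (y, w + (t : ℂ) • σ c y)) := by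
        have := (hσ c y hy).continuousAt
        exact ContinuousAt.tendsto (f := fun y' : E => (y', w + (t : ℂ) • σ c y')) (by fun_prop)
      filter_upwards [hBo.mem_nhds hy, c1.eventually h1.eventually_analyticAt,
        c2.eventually h2.eventually_analyticAt, ((h2.continuousAt.tendsto.comp
          c2).prodMk_nhds (h1.continuousAt.tendsto.comp c1)).eventually
          (isOpen_ne_fun continuous_fst continuous_snd |>.mem_nhds h3)] with y' a1 a2 a3 a4
      exact ⟨a1, t, w, a2, a3, a4⟩
    · refine isOpenMap_fst _ ((isOpen_analyticAt ℂ f).inter ?_)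
      exact ((TopologicalSpace.isBasis_countableBasis F).isOpen b.2).preimage continuous_snd
  · rintro (c | b) y hy
    · rw [mem_closure_iff]
      intro o ho hyo
      by_contra hcon
      refine c.2 fun t => ?_
      refine IsInvariantOver.of_isOpen hB hf (fun y hy => analyticAt_const.smul (hσ c y hy))
        (hB'.inter ho) ⟨y, hBB' hy, hy, hyo⟩ ?_
      intro y' hy' w h1 h2
      by_contra h3
      exact hcon ⟨y', hy'.2, hBB' hy'.1, t, w, h1, h2, h3⟩
    · rw [mem_closure_iff]
      intro o ho hyo
      obtain ⟨w, hw⟩ := TopologicalSpace.nonempty_of_mem_countableBasis b.2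
      have hb := (TopologicalSpace.isBasis_countableBasis F).isOpen b.2
      obtain ⟨z, hz, hz1, hz2⟩ := ((hf y (hBB' hy) w).frequently_analyticAt.and_eventually
        ((ho.prod hb).mem_nhds (show (y, w) ∈ o ×ˢ b.1 from ⟨hyo, hw⟩))).exists
      exact ⟨z.1, hz1, z, ⟨hz, hz2⟩, rfl⟩

omit [FiniteDimensional ℂ E] in
-- Near a point where `f` is analytic, `f (y, w + t • σ y)` is holomorphic in small complex `t` and
-- constant for real `t`, hence constant. The bound `ε` is uniform near that point, from which
-- invariance spreads over `B`.
theorem exists_isInvariantOver_complex {f : E × F → ℂ} {B : Set E} (hBo : IsOpen B)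
    (hB : IsPreconnected B) (hne : B.Nonempty) (hf : ∀ y ∈ B, ∀ w, IsMeromorphicNear f (y, w))
    {σ : E → F} (hσ : AnalyticOnNhd ℂ σ B)
    (h : ∀ t : ℝ, IsInvariantOver f B fun y => (t : ℂ) • σ y) :
    ∃ ε > 0, ∀ t : ℂ, ‖t‖ < ε → IsInvariantOver f B fun y => t • σ y := by
  have : CompleteSpace F := FiniteDimensional.complete ℂ F
  obtain ⟨y, hy⟩ := hne
  obtain ⟨z, hz, hzB⟩ := ((hf y hy 0).frequently_analyticAt.and_eventually
    (continuous_fst.continuousAt.preimage_mem_nhds (hBo.mem_nhds hy))).exists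
  have hzB : z.1 ∈ B := hzB
  let Ψ : (E × F) × ℂ → E × F := fun p => (p.1.1, p.1.2 + p.2 • σ p.1.1)
  have hσz : ContinuousAt σ z.1 := (hσ z.1 hzB).continuousAt
  have hΨ : Tendsto Ψ (𝓝 z ×ˢ 𝓝 0) (𝓝 z) := by
    have h1 : ContinuousAt (fun p : (E × F) × ℂ => σ p.1.1) (z, 0) :=
      ContinuousAt.comp' (f := fun p : (E × F) × ℂ => p.1.1) hσz (by fun_prop)
    have : ContinuousAt Ψ (z, 0) := by
      dsimp only [Ψ]; fun_prop
    have h0 : Ψ (z, 0) = z := by simp [Ψ]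
    rwa [ContinuousAt, h0, nhds_prod_eq] at this
  have hev := hΨ.eventually hz.eventually_analyticAt
  obtain ⟨P, hP, Q, hQ, hPQ⟩ := Filter.eventually_prod_iff.1 hev
  obtain ⟨ε, hε, hεQ⟩ := Metric.eventually_nhds_iff_ball.1 hQ
  refine ⟨ε, hε, fun t ht => ?_⟩
  refine .of_eventually hB hf (fun y hy => analyticAt_const.smul (hσ y hy)) (z := z) hzB ?_
  filter_upwards [hP, continuous_fst.continuousAt.preimage_mem_nhds (hBo.mem_nhds hzB)] with u hu huB
    hu1 hu2
  have huB : u.1 ∈ B := huB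
  let g : ℂ → ℂ := fun t => f (u.1, u.2 + t • σ u.1)
  have hg : AnalyticOnNhd ℂ g (Metric.ball 0 ε) := fun s hs => by
    refine AnalyticAt.comp (g := f) (f := fun s : ℂ => (u.1, u.2 + s • σ u.1))
      (hPQ hu (hεQ s hs)) ?_
    exact analyticAt_const.prod (analyticAt_const.add (analyticAt_id.smul analyticAt_const))
  have hfreq : ∃ᶠ s in 𝓝[≠] (0 : ℂ), g s = f u := by
    have ht : Tendsto (fun s : ℝ => (s : ℂ)) (𝓝[≠] 0) (𝓝[≠] 0) := by
      refine tendsto_nhdsWithin_iff.2 ⟨?_, ?_⟩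
      · exact (Complex.continuous_ofReal.tendsto' 0 0 Complex.ofReal_zero).mono_left
          nhdsWithin_le_nhds
      · filter_upwards [self_mem_nhdsWithin] with s hs
        simpa using hs
    refine ht.frequently (Eventually.frequently ?_)
    have : ∀ᶠ s : ℝ in 𝓝[≠] 0, s ∈ Metric.ball (0 : ℝ) ε :=
      nhdsWithin_le_nhds (Metric.ball_mem_nhds 0 hε)
    filter_upwards [this] with s hs
    exact h s u.1 huB u.2 hu1 (hPQ hu (hεQ (s : ℂ) (by simpa using hs)))
  exact hg.eqOn_of_preconnected_of_frequently_eq (fun _ _ => analyticAt_const)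
    (convex_ball 0 ε).isPreconnected (Metric.mem_ball_self hε) hfreq (by simpa using ht)

/-- On a generic fibre, the lattice vectors along which `f` is invariant over the whole base form a
saturated sublattice whose rank is at least twice the complex dimension of its span. -/
theorem exists_fibre_finrank_le {f : E × F → ℂ} {B : Set E} (hBo : IsOpen B)
    (hB : IsPreconnected B) (hf : ∀ y ∈ B, ∀ w, IsMeromorphicNear f (y, w))
    {Z : Type*} [AddCommGroup Z] [Module.Free ℤ Z] [Module.Finite ℤ Z] [Countable Z]
    (ev : E → Z →ₗ[ℤ] F) (hσ : ∀ c, AnalyticOnNhd ℂ (fun y => ev y c) B)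
    (hper : ∀ c, IsInvariantOver f B fun y => ev y c)
    (hspan : ∀ y ∈ B, Submodule.span ℝ (range (ev y)) = ⊤)
    (hrank : finrank ℤ Z = 2 * finrank ℂ F)
    {B' : Set E} (hB' : IsOpen B') (hBB' : B' ⊆ B) (hne : B'.Nonempty) :
    ∃ y ∈ B', ∃ G : AddSubgroup F,
      (∀ v, v ∈ G ↔ ∀ w, AnalyticAt ℂ f (y, w) → AnalyticAt ℂ f (y, w + v) →
        f (y, w + v) = f (y, w)) ∧
      ∃ L : Submodule ℤ Z,
        (∀ c, c ∈ L ↔ ∀ t : ℝ, IsInvariantOver f B fun y => (t : ℂ) • ev y c) ∧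
        (∀ (m : ℤ) (c : Z), m ≠ 0 → m • c ∈ L → c ∈ L) ∧
        (∀ c ∈ L, ∀ t : ℂ, t • ev y c ∈ G) ∧
        2 * finrank ℂ (Submodule.span ℂ (ev y '' L)) ≤ finrank ℤ L := by
  obtain ⟨y, hy, hd, hgen⟩ := exists_generic_fibre hBo hB hf (fun c y => ev y c) hσ hB' hBB' hne
  have hyB := hBB' hy
  let G := fibrePeriods f y hd
  have hsm : ∀ (t : ℝ) (v : F), t • v = (t : ℂ) • v := fun t v => (Complex.coe_smul t v).symm
  let G₀ : Submodule ℝ F :=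
    { carrier := {v | ∀ t : ℝ, t • v ∈ G}
      add_mem' := fun ha hb t => by rw [smul_add]; exact G.add_mem (ha t) (hb t)
      zero_mem' := fun t => by rw [smul_zero]; exact G.zero_mem
      smul_mem' := fun s v hv t => by rw [smul_smul]; exact hv _ }
  let L : Submodule ℤ Z := (G₀.restrictScalars ℤ).comap (ev y)
  have hL : ∀ c, c ∈ L ↔ ∀ t : ℝ, IsInvariantOver f B fun y => (t : ℂ) • ev y c := fun c => by
    refine ⟨fun hc => hgen c fun t w h1 h2 => ?_, fun hc t w h1 h2 => ?_⟩
    · have := hc t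
      rw [hsm] at this
      exact this w h1 h2
    · rw [hsm] at h2 ⊢
      exact hc t y hyB w h1 h2
  have hLC : ∀ c ∈ L, ∀ t : ℂ, t • ev y c ∈ G := fun c hc t => by
    obtain ⟨ε, hε, hinv⟩ := exists_isInvariantOver_complex hBo hB ⟨y, hyB⟩ hf (hσ c) ((hL c).1 hc)
    -- Only small complex multiples are known to be periods; an arbitrary one is `N` times a small
    -- one, and `G` is a group.
    obtain ⟨N, hN⟩ := exists_nat_gt (‖t‖ / ε)
    have hNpos : (0 : ℝ) < N := lt_of_le_of_lt (by positivity) hN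
    have hNne : (N : ℂ) ≠ 0 := by exact_mod_cast hNpos.ne'
    have hlt : ‖t / N‖ < ε := by
      rw [norm_div, Complex.norm_natCast, div_lt_iff₀ hNpos]
      rwa [div_lt_iff₀ hε, mul_comm] at hN
    have hmem : (t / N) • ev y c ∈ G := fun w h1 h2 => hinv _ hlt y hyB w h1 h2
    have := G.nsmul_mem hmem N
    rwa [← Nat.cast_smul_eq_nsmul ℂ, smul_smul, mul_div_cancel₀ _ hNne] at this
  refine ⟨y, hy, G, fun v => Iff.rfl, L, hL, fun m c hm hc t => ?_, hLC, ?_⟩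
  · have := hc (t / m)
    rw [map_zsmul, ← Int.cast_smul_eq_zsmul ℝ, smul_smul,
      div_mul_cancel₀ _ (by exact_mod_cast hm : (m : ℝ) ≠ 0)] at this
    exact this
  · have h1 : finrank ℤ L = finrank ℝ G₀ := finrank_comap_of_forall_line (ev y) (hspan y hyB)
      (by rw [hrank, finrank_real_of_complex]) G (isClosed_fibrePeriods f y hd)
      (fun c w h1 h2 => hper c y hyB w h1 h2) G₀ fun v => Iff.rfl
    -- The rank of `L` is `dim_ℝ G₀`, so it remains to see that the complex span of `L` lies in
    -- `G₀`.
    rw [h1, ← finrank_real_of_complex]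
    refine Submodule.finrank_mono (s := (Submodule.span ℂ (ev y '' L)).restrictScalars ℝ)
      (t := G₀) fun v hv t => ?_
    rw [hsm]
    have hind : ∀ t : ℂ, t • v ∈ G := by
      have hv' : v ∈ Submodule.span ℂ (ev y '' L) := hv
      induction hv' using Submodule.span_induction with
      | mem x hx =>
        obtain ⟨c, hc, rfl⟩ := hx
        exact hLC c hc
      | zero => intro t; rw [smul_zero]; exact G.zero_mem
      | add a b _ _ ha hb =>
        intro t
        rw [smul_add]
        exact G.add_mem (ha ‹_› t) (hb ‹_› t)
      | smul s a _ ha => intro t; rw [smul_smul]; exact ha ‹_› _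
    exact hind t

end GenericFibre

/-! ### Meromorphic functions in charts -/

section Charts

variable {E : Type*} [NormedAddCommGroup E] [NormedSpace ℂ E]
  {H : Type*} [TopologicalSpace H] {I : ModelWithCorners ℂ E H} [I.Boundaryless]
  {X : Type*} [TopologicalSpace X] [ChartedSpace H X] [IsManifold I ω X]

theorem contMDiffAt_extChartAt_symm_of_mem (x₀ : X) {u : E} (hu : u ∈ (extChartAt I x₀).target) :
    ContMDiffAt 𝓘(ℂ, E) I ω (extChartAt I x₀).symm u :=
  (contMDiffOn_extChartAt_symm x₀).contMDiffAt ((isOpen_extChartAt_target x₀).mem_nhds hu)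

theorem analyticAt_comp_extChartAt_symm {F : Type*} [NormedAddCommGroup F] [NormedSpace ℂ F]
    [CompleteSpace F] (x₀ : X) {u : E} (hu : u ∈ (extChartAt I x₀).target) {f : X → F}
    (hf : ContMDiffAt I 𝓘(ℂ, F) ω f ((extChartAt I x₀).symm u)) :
    AnalyticAt ℂ (f ∘ (extChartAt I x₀).symm) u :=
  (contMDiffAt_iff_contDiffAt.1
    (ContMDiffAt.comp u hf (contMDiffAt_extChartAt_symm_of_mem x₀ hu))).analyticAt

theorem analyticAt_comp_extChartAt_symm_iff (x₀ : X) {u : E}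
    (hu : u ∈ (extChartAt I x₀).target) {f : X → ℂ} :
    AnalyticAt ℂ (f ∘ (extChartAt I x₀).symm) u ↔
      ContMDiffAt I 𝓘(ℂ) ω f ((extChartAt I x₀).symm u) := by
  refine ⟨fun h => ?_, analyticAt_comp_extChartAt_symm x₀ hu⟩
  have hs := (extChartAt I x₀).map_target hu
  have hr := (extChartAt I x₀).right_inv hu
  have h1 : ContMDiffAt 𝓘(ℂ, E) 𝓘(ℂ) ω (f ∘ (extChartAt I x₀).symm)
      (extChartAt I x₀ ((extChartAt I x₀).symm u)) := by
    rw [hr]; exact h.contDiffAt.contMDiffAt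
  have h2 := ContMDiffAt.comp _ h1 (contMDiffAt_extChartAt' (I := I) (x := x₀)
    (by rwa [← extChartAt_source I]))
  refine h2.congr_of_eventuallyEq ?_
  filter_upwards [extChartAt_source_mem_nhds' (I := I) hs] with z hz
  rw [Function.comp_apply, Function.comp_apply, (extChartAt I x₀).left_inv hz]

theorem IsMeromorphicFun.isMeromorphicNear {f : X → ℂ} (hf : IsMeromorphicFun I f) (x₀ : X) {u : E}
    (hu : u ∈ (extChartAt I x₀).target) :
    IsMeromorphicNear (f ∘ (extChartAt I x₀).symm) u := by
  obtain ⟨U, hU, hxU, g, h, hg, hh, hne, heq⟩ := hf ((extChartAt I x₀).symm u)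
  have hs := (extChartAt I x₀).map_target hu
  have hr := (extChartAt I x₀).right_inv hu
  have hUn := hU.mem_nhds hxU
  refine ⟨g ∘ (extChartAt I x₀).symm, h ∘ (extChartAt I x₀).symm,
    analyticAt_comp_extChartAt_symm x₀ hu (hg.contMDiffAt hUn),
    analyticAt_comp_extChartAt_symm x₀ hu (hh.contMDiffAt hUn), ?_, ?_⟩
  · have hc : Tendsto (extChartAt I x₀) (𝓝 ((extChartAt I x₀).symm u)) (𝓝 u) := by
      have := (continuousAt_extChartAt' (I := I) hs).tendsto
      rwa [hr] at this
    refine hc.frequently (((hne _ hxU).and_eventually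
      (extChartAt_source_mem_nhds' (I := I) hs)).mono ?_)
    rintro z ⟨hz, hzs⟩
    rwa [Function.comp_apply, (extChartAt I x₀).left_inv hzs]
  · have hc := (contMDiffAt_extChartAt_symm_of_mem (I := I) x₀ hu).continuousAt
    filter_upwards [hc.preimage_mem_nhds hUn] with z hz hz'
    exact heq _ hz hz'

end Charts

/-! ### Local trivializations of the bundle over a chart -/

section LocalModel

variable {E : Type*} [NormedAddCommGroup E] [NormedSpace ℂ E]
  {F : Type*} [NormedAddCommGroup F] [NormedSpace ℂ F]
  {M : Type*} [TopologicalSpace M] [ChartedSpace E M]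
  {V : M → Type*} [∀ x, AddCommGroup (V x)] [∀ x, Module ℂ (V x)]
  [TopologicalSpace (TotalSpace F V)] [∀ x, TopologicalSpace (V x)]
  [FiberBundle F V]

variable (E) in
/-- `v` is a period of the restriction of `f` to the fibre over `x`. -/
def IsFibrePeriod (f : TotalSpace F V → ℂ) {x : M} (l : V x) : Prop :=
  ∀ v : V x, (⟨x, v⟩ : TotalSpace F V) ∈ regularLocus (𝓘(ℂ, E).prod 𝓘(ℂ, F)) f →
    (⟨x, v + l⟩ : TotalSpace F V) ∈ regularLocus (𝓘(ℂ, E).prod 𝓘(ℂ, F)) f →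
    f ⟨x, v + l⟩ = f ⟨x, v⟩

variable (E F V) in
/-- The domain in the model space of the chart at `p₀` over which the trivialization of `V` at `p₀` is
defined. -/
def chartDomain (p₀ : M) : Set E :=
  (chartAt E p₀).target ∩ (chartAt E p₀).symm ⁻¹' (trivializationAt F V p₀).baseSet

variable (E) in
/-- The function `f` read in the chart of the total space over `p₀`. -/
noncomputable def readInChart (f : TotalSpace F V → ℂ) (p₀ : M) : E × F → ℂ :=
  f ∘ (extChartAt (𝓘(ℂ, E).prod 𝓘(ℂ, F)) (⟨p₀, 0⟩ : TotalSpace F V)).symm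

omit [NormedSpace ℂ E] [NormedSpace ℂ F] [∀ x, AddCommGroup (V x)] [∀ x, Module ℂ (V x)] in
theorem isOpen_chartDomain (p₀ : M) : IsOpen (chartDomain E F V p₀) :=
  (chartAt E p₀).isOpen_inter_preimage_symm (trivializationAt F V p₀).open_baseSet

omit [NormedSpace ℂ E] [NormedSpace ℂ F] [∀ x, AddCommGroup (V x)] [∀ x, Module ℂ (V x)] in
theorem chartDomain_mem_nhds (p₀ : M) : chartDomain E F V p₀ ∈ 𝓝 (chartAt E p₀ p₀) := by
  refine (isOpen_chartDomain p₀).mem_nhds ⟨mem_chart_target E p₀, ?_⟩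
  rw [mem_preimage, (chartAt E p₀).left_inv (mem_chart_source E p₀)]
  exact mem_baseSet_trivializationAt F V p₀

variable (F V) in
omit [NormedSpace ℂ E] [NormedSpace ℂ F] [∀ x, AddCommGroup (V x)] [∀ x, Module ℂ (V x)] in
theorem exists_ball_subset_chartDomain (p₀ : M) {N : Set M} (hN : N ∈ 𝓝 p₀) :
    ∃ r > 0, Metric.ball (chartAt E p₀ p₀) r ⊆ chartDomain E F V p₀ ∧
      ∀ y ∈ Metric.ball (chartAt E p₀ p₀) r, (chartAt E p₀).symm y ∈ N := by
  have h2 : Tendsto (chartAt E p₀).symm (𝓝 (chartAt E p₀ p₀)) (𝓝 p₀) := by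
    have := ((chartAt E p₀).continuousAt_symm (mem_chart_target E p₀)).tendsto
    rwa [(chartAt E p₀).left_inv (mem_chart_source E p₀)] at this
  obtain ⟨r, hr, hb⟩ := Metric.mem_nhds_iff.1
    (inter_mem (chartDomain_mem_nhds (E := E) (F := F) (V := V) p₀) (h2 hN))
  exact ⟨r, hr, fun y hy => (hb hy).1, fun y hy => (hb hy).2⟩

omit [∀ x, Module ℂ (V x)] in
theorem extChartAt_totalSpace_target (p₀ : M) :
    (extChartAt (𝓘(ℂ, E).prod 𝓘(ℂ, F)) (⟨p₀, 0⟩ : TotalSpace F V)).target =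
      chartDomain E F V p₀ ×ˢ univ := by
  rw [FiberBundle.extChartAt_target]
  simp [chartDomain, extChartAt, OpenPartialHomeomorph.extend]

omit [∀ x, Module ℂ (V x)] in
theorem extChartAt_totalSpace_symm {p₀ : M} {y : E} (hy : y ∈ chartDomain E F V p₀) (w : F) :
    (extChartAt (𝓘(ℂ, E).prod 𝓘(ℂ, F)) (⟨p₀, 0⟩ : TotalSpace F V)).symm (y, w) =
      ⟨(chartAt E p₀).symm y, (trivializationAt F V p₀).symm ((chartAt E p₀).symm y) w⟩ := by
  rw [FiberBundle.extChartAt]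
  have := (trivializationAt F V p₀).mk_symm hy.2 w
  rw [this]
  simp [extChartAt, OpenPartialHomeomorph.extend]

variable [VectorBundle ℂ F V]

/-- The isomorphism of the fibre over a point of the chart with the model fibre. -/
noncomputable def fibreEquiv (p₀ : M) {y : E} (hy : y ∈ chartDomain E F V p₀) :
    V ((chartAt E p₀).symm y) ≃L[ℂ] F :=
  (trivializationAt F V p₀).continuousLinearEquivAt ℂ _ hy.2

theorem readInChart_apply (f : TotalSpace F V → ℂ) {p₀ : M} {y : E}
    (hy : y ∈ chartDomain E F V p₀) (v : V ((chartAt E p₀).symm y)) :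
    readInChart E f p₀ (y, fibreEquiv p₀ hy v) = f ⟨_, v⟩ := by
  rw [readInChart, Function.comp_apply, extChartAt_totalSpace_symm hy]
  congr 2
  exact (fibreEquiv p₀ hy).symm_apply_apply v

variable [IsManifold 𝓘(ℂ, E) ω M] [ContMDiffVectorBundle ω F V 𝓘(ℂ, E)]

theorem analyticAt_readInChart_iff (f : TotalSpace F V → ℂ) {p₀ : M} {y : E}
    (hy : y ∈ chartDomain E F V p₀) (v : V ((chartAt E p₀).symm y)) :
    AnalyticAt ℂ (readInChart E f p₀) (y, fibreEquiv p₀ hy v) ↔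
      (⟨_, v⟩ : TotalSpace F V) ∈ regularLocus (𝓘(ℂ, E).prod 𝓘(ℂ, F)) f := by
  have hmem : (y, fibreEquiv p₀ hy v) ∈
      (extChartAt (𝓘(ℂ, E).prod 𝓘(ℂ, F)) (⟨p₀, 0⟩ : TotalSpace F V)).target := by
    rw [extChartAt_totalSpace_target]; exact ⟨hy, mem_univ _⟩
  rw [readInChart, analyticAt_comp_extChartAt_symm_iff _ hmem, extChartAt_totalSpace_symm hy]
  have : (trivializationAt F V p₀).symm ((chartAt E p₀).symm y) (fibreEquiv p₀ hy v) = v :=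
    (fibreEquiv p₀ hy).symm_apply_apply v
  rw [this]
  rfl

theorem isMeromorphicNear_readInChart {f : TotalSpace F V → ℂ}
    (hf : IsMeromorphicFun (𝓘(ℂ, E).prod 𝓘(ℂ, F)) f) {p₀ : M} {y : E}
    (hy : y ∈ chartDomain E F V p₀) (w : F) : IsMeromorphicNear (readInChart E f p₀) (y, w) :=
  hf.isMeromorphicNear _ (by rw [extChartAt_totalSpace_target]; exact ⟨hy, mem_univ _⟩)

theorem isFibrePeriod_iff (f : TotalSpace F V → ℂ) {p₀ : M} {y : E}
    (hy : y ∈ chartDomain E F V p₀) (l : V ((chartAt E p₀).symm y)) :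
    IsFibrePeriod E f l ↔ ∀ w, AnalyticAt ℂ (readInChart E f p₀) (y, w) →
      AnalyticAt ℂ (readInChart E f p₀) (y, w + fibreEquiv p₀ hy l) →
      readInChart E f p₀ (y, w + fibreEquiv p₀ hy l) = readInChart E f p₀ (y, w) := by
  rw [(fibreEquiv p₀ hy).surjective.forall]
  refine forall_congr' fun v => ?_
  rw [← map_add, analyticAt_readInChart_iff, analyticAt_readInChart_iff, readInChart_apply,
    readInChart_apply]

open Classical in
variable (F) in
/-- A section over `U` read in the chart and trivialization at `p₀`. -/
noncomputable def readSection {U : TopologicalSpace.Opens M} (s : ∀ x : U, V x) (p₀ : M) : E → F :=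
  (fun x : M => if h : x ∈ U then (trivializationAt F V p₀ ⟨x, s ⟨x, h⟩⟩).2 else 0) ∘
    (chartAt E p₀).symm

omit [NormedSpace ℂ E] [IsManifold 𝓘(ℂ, E) ω M] [ContMDiffVectorBundle ω F V 𝓘(ℂ, E)] in
theorem readSection_apply {U : TopologicalSpace.Opens M} (s : ∀ x : U, V x) {p₀ : M} {y : E}
    (hy : y ∈ chartDomain E F V p₀) (hU : (chartAt E p₀).symm y ∈ U) :
    readSection F s p₀ y = fibreEquiv p₀ hy (s ⟨_, hU⟩) := by
  simp only [readSection, Function.comp_apply, dif_pos hU]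
  rfl

theorem analyticAt_readSection [CompleteSpace F] {U : TopologicalSpace.Opens M} {s : ∀ x : U, V x}
    (hs : IsHolomorphicSection E F V U s) {p₀ : M} {y : E} (hy : y ∈ chartDomain E F V p₀)
    (hU : (chartAt E p₀).symm y ∈ U) : AnalyticAt ℂ (readSection F s p₀) y := by
  classical
  have h0 : ⇑(extChartAt 𝓘(ℂ, E) p₀).symm = (chartAt E p₀).symm := by
    simp [extChartAt, OpenPartialHomeomorph.extend]
  rw [readSection, ← h0]
  refine analyticAt_comp_extChartAt_symm p₀ (by simpa [extChartAt, OpenPartialHomeomorph.extend]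
    using hy.1) ?_
  rw [h0]
  -- The zero extension need not be continuous at the boundary of `U`; smoothness is tested only at
  -- a point of the open set `U`.
  let S : M → TotalSpace F V := fun x => if h : x ∈ U then ⟨x, s ⟨x, h⟩⟩ else ⟨x, 0⟩
  have hS : ContMDiffAt 𝓘(ℂ, E) (𝓘(ℂ, E).prod 𝓘(ℂ, F)) ω S ((chartAt E p₀).symm y) := by
    have h1 := hs ⟨_, hU⟩
    have h2 : (fun x : U => (⟨x, s x⟩ : TotalSpace F V)) = fun x : U => S x := by
      funext x
      simp [S]
    rw [h2] at h1
    exact contMDiffAt_subtype_iff.1 h1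
  have hSs : S ((chartAt E p₀).symm y) ∈ (trivializationAt F V p₀).source := by
    rw [Trivialization.mem_source]
    simp only [S, dif_pos hU]
    exact hy.2
  have h3 := ((trivializationAt F V p₀).contMDiffAt_iff hSs).1 hS |>.2
  refine h3.congr_of_eventuallyEq ?_
  filter_upwards [U.isOpen.mem_nhds hU] with x hx
  have hx : x ∈ U := hx
  simp [S, dif_pos hx]

end LocalModel

/-! ### Stalks of a sheaf of lattices -/

section Sheaf

open Module

variable {E : Type*} [NormedAddCommGroup E] [NormedSpace ℂ E]
  {F : Type*} [NormedAddCommGroup F] [NormedSpace ℂ F]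
  {M : Type*} [TopologicalSpace M] [ChartedSpace E M]
  {V : M → Type*} [∀ x, AddCommGroup (V x)] [∀ x, Module ℂ (V x)]
  [TopologicalSpace (TotalSpace F V)] [∀ x, TopologicalSpace (V x)]
  [FiberBundle F V] {n : ℕ}

namespace LatticeSheaf

theorem isTransport_germ (Λ : LatticeSheaf E F V n) {U : TopologicalSpace.Opens M}
    (s : Λ.sec U) {p q : M} (γ : Path p q) (hγ : ∀ t, γ t ∈ U) (hp : p ∈ U) (hq : q ∈ U) :
    Λ.IsTransport γ (Λ.germ s ⟨p, hp⟩) (Λ.germ s ⟨q, hq⟩) := by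
  refine ⟨fun t => ⟨γ t, s.1 ⟨γ t, hγ t⟩⟩, fun t₀ => ⟨U, s, Eventually.of_forall fun t =>
    ⟨hγ t, rfl⟩⟩, ?_, ?_⟩
  · have : ∀ (x : M) (hx : x ∈ U), x = p →
        (⟨x, s.1 ⟨x, hx⟩⟩ : TotalSpace F V) = ⟨p, s.1 ⟨p, hp⟩⟩ := by
      rintro _ _ rfl; rfl
    exact this _ _ γ.source
  · have : ∀ (x : M) (hx : x ∈ U), x = q →
        (⟨x, s.1 ⟨x, hx⟩⟩ : TotalSpace F V) = ⟨q, s.1 ⟨q, hq⟩⟩ := by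
      rintro _ _ rfl; rfl
    exact this _ _ γ.target

theorem span_real_image (Λ : LatticeSheaf E F V n) {x : M} (A : V x ≃L[ℂ] F) :
    Submodule.span ℝ (A '' (Λ.stalk x : Set (V x))) = ⊤ := by
  let A' : V x ≃ₗ[ℝ] F := A.toLinearEquiv.restrictScalars ℝ
  have h1 : A '' (Λ.stalk x : Set (V x)) = A' '' (Λ.stalk x : Set (V x)) := rfl
  have h2 : Submodule.span ℝ (Λ.stalk x : Set (V x)) = ⊤ := Λ.span_real x
  rw [h1]
  change Submodule.span ℝ ((A' : V x →ₗ[ℝ] F) '' _) = ⊤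
  rw [← Submodule.map_span, h2, Submodule.map_top, LinearMap.range_eq_top]
  exact A'.surjective

variable [VectorBundle ℂ F V] [FiniteDimensional ℂ F]

/-- The stalk is discrete and spans over `ℝ`, so its rank is `2 * n`, the number of generators. By
rank-nullity there is no room for a relation. This is the injectivity of evaluation on germs. -/
theorem linearIndependent_int (hn : finrank ℂ F = n) (Λ : LatticeSheaf E F V n) {x : M}
    (b : Fin (2 * n) → V x)
    (hb : ∀ l, l ∈ Λ.stalk x ↔ ∃ c : Fin (2 * n) → ℤ, ∑ i, c i • b i = l) :
    LinearIndependent ℤ b := by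
  let A : V x ≃L[ℂ] F := (trivializationAt F V x).continuousLinearEquivAt ℂ x
    (mem_baseSet_trivializationAt F V x)
  let g : (Fin (2 * n) → ℤ) →ₗ[ℤ] F := Fintype.linearCombination ℤ fun i => A (b i)
  have hg : ∀ c, g c = A (∑ i, c i • b i) := fun c => by
    simp [g, Fintype.linearCombination_apply]
  let Γ : Submodule ℤ F := LinearMap.range g
  have hΓ : (Γ : Set F) = A '' (Λ.stalk x : Set (V x)) := by
    ext v
    constructor
    · rintro ⟨c, rfl⟩
      exact ⟨_, (hb _).2 ⟨c, rfl⟩, (hg c).symm⟩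
    · rintro ⟨l, hl, rfl⟩
      obtain ⟨c, rfl⟩ := (hb l).1 hl
      exact ⟨c, hg c⟩
  have hdisc : DiscreteTopology (Γ : Set F) := by
    rw [hΓ]
    have : DiscreteTopology (Λ.stalk x : Set (V x)) := Λ.discrete x
    exact (A.toHomeomorph.image (Λ.stalk x : Set (V x))).discreteTopology
  have : DiscreteTopology Γ := hdisc
  have : IsZLattice ℝ Γ := ⟨by rw [hΓ]; exact Λ.span_real_image A⟩
  have h1 := ZLattice.rank ℝ Γ
  have h2 := LinearMap.finrank_range_add_finrank_ker_int g
  change finrank ℤ Γ + _ = _ at h2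
  rw [h1, finrank_real_of_complex, hn, finrank_fin_fun, Nat.add_eq_left,
    Submodule.finrank_eq_zero] at h2
  rw [Fintype.linearIndependent_iff]
  intro c hc i
  have : g c = 0 := by rw [hg, hc, map_zero]
  exact congrFun (LinearMap.ker_eq_bot'.1 h2 c this) i

theorem exists_frame (hn : finrank ℂ F = n) (Λ : LatticeSheaf E F V n) (q : M) :
    ∃ U : TopologicalSpace.Opens M, q ∈ U ∧ ∃ b : Fin (2 * n) → ∀ x : U, V x,
      (∀ i, b i ∈ Λ.sec U) ∧
      (∀ (U' : TopologicalSpace.Opens M) (hU : U' ≤ U), ∀ t ∈ Λ.sec U',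
        ∃ c : LocallyConstant U' (Fin (2 * n) → ℤ),
          ∀ x : U', t x = ∑ i, c x i • b i ⟨x, hU x.2⟩) ∧
      ∀ x : U, (∀ l, l ∈ Λ.stalk (x : M) ↔ ∃ c : Fin (2 * n) → ℤ, ∑ i, c i • b i x = l) ∧
        LinearIndependent ℤ fun i => b i x := by
  obtain ⟨U, hq, b, hb, h⟩ := Λ.locally_const q
  refine ⟨U, hq, b, hb, fun U' hU t ht => (h U' hU t ht).exists, fun x => ?_⟩
  have key : ∀ l, l ∈ Λ.stalk (x : M) ↔ ∃ c : Fin (2 * n) → ℤ, ∑ i, c i • b i x = l := by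
    intro l
    constructor
    · rintro ⟨U', hx, s, hs, rfl⟩
      obtain ⟨c, hc, -⟩ := h (U' ⊓ U) inf_le_right _ (Λ.restrict U' (U' ⊓ U) inf_le_left s hs)
      exact ⟨c ⟨x, hx, x.2⟩, (hc ⟨x, hx, x.2⟩).symm⟩
    · rintro ⟨c, rfl⟩
      exact (Λ.stalk (x : M)).sum_mem fun i _ => (Λ.stalk (x : M)).zsmul_mem
        ⟨U, x.2, b i, hb i, rfl⟩ _
  exact ⟨key, Λ.linearIndependent_int hn _ key⟩

/-- Two sections of a sheaf of lattices with the same value at a point agree near it. -/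
theorem eventually_eq_of_eq (hn : finrank ℂ F = n) (Λ : LatticeSheaf E F V n)
    {U U' : TopologicalSpace.Opens M} {s : ∀ x : U, V x} {s' : ∀ x : U', V x}
    (hs : s ∈ Λ.sec U) (hs' : s' ∈ Λ.sec U') {x : M} (hx : x ∈ U) (hx' : x ∈ U')
    (h : s ⟨x, hx⟩ = s' ⟨x, hx'⟩) :
    ∀ᶠ z in 𝓝 x, ∃ (hz : z ∈ U) (hz' : z ∈ U'), s ⟨z, hz⟩ = s' ⟨z, hz'⟩ := by
  obtain ⟨U₀, hx₀, b, hb, hc, hU₀⟩ := Λ.exists_frame hn x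
  let N : TopologicalSpace.Opens M := U ⊓ U' ⊓ U₀
  have hxN : x ∈ N := ⟨⟨hx, hx'⟩, hx₀⟩
  obtain ⟨c, hcs⟩ := hc N inf_le_right _
    (Λ.restrict U N (inf_le_left.trans inf_le_left) s hs)
  obtain ⟨c', hcs'⟩ := hc N inf_le_right _
    (Λ.restrict U' N (inf_le_left.trans inf_le_right) s' hs')
  -- Independence of the frame at `x` identifies the coordinates there; being locally constant, they
  -- then agree near `x`.
  have heq : c ⟨x, hxN⟩ = c' ⟨x, hxN⟩ := by
    have h1 := hcs ⟨x, hxN⟩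
    have h2 := hcs' ⟨x, hxN⟩
    have hli := (hU₀ ⟨x, hx₀⟩).2
    rw [Fintype.linearIndependent_iff] at hli
    have h3 : ∑ i, (c ⟨x, hxN⟩ i - c' ⟨x, hxN⟩ i) • b i ⟨x, hx₀⟩ = 0 := by
      simp only [sub_smul, Finset.sum_sub_distrib]
      rw [← h1, ← h2, sub_eq_zero]
      exact h
    exact funext fun i => sub_eq_zero.1 (hli _ h3 i)
  have hopen : IsOpen {z : N | c z = c' z} := by
    rw [isOpen_iff_mem_nhds]
    intro z hz
    filter_upwards [(c.isLocallyConstant.eventually_eq z), (c'.isLocallyConstant.eventually_eq z)]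
      with y h1 h2
    exact (h1.trans hz).trans h2.symm
  have himg := N.isOpen.isOpenMap_subtype_val _ hopen
  filter_upwards [himg.mem_nhds ⟨⟨x, hxN⟩, heq, rfl⟩] with z hz
  obtain ⟨z, hz, rfl⟩ := hz
  have hz : c z = c' z := hz
  refine ⟨z.2.1.1, z.2.1.2, ?_⟩
  rw [hcs z, hcs' z, hz]

/-! ### Invariance of a function along germs of sections -/

/-- Near `x`, the real multiples of the section of `Λ` with value `l` at `x` are fibrewise periods of
`f`. -/
def IsInvariantGerm (Λ : LatticeSheaf E F V n) (f : TotalSpace F V → ℂ) (z : TotalSpace F V) :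
    Prop :=
  ∃ (U : TopologicalSpace.Opens M) (hx : z.1 ∈ U), ∃ s ∈ Λ.sec U, s ⟨z.1, hx⟩ = z.2 ∧
    ∀ (x : U) (t : ℝ), IsFibrePeriod E f ((t : ℂ) • s x)

variable [IsManifold 𝓘(ℂ, E) ω M] [ContMDiffVectorBundle ω F V 𝓘(ℂ, E)]

section Chart

variable {Λ : LatticeSheaf E F V n} {f : TotalSpace F V → ℂ} {p₀ : M} {B : Set E}
  {U : TopologicalSpace.Opens M} {s : ∀ x : U, V x}

/-- The section witnessing the germ condition agrees with `s` near `x`, so invariance along `s`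
holds near `x` and the identity theorem extends it over `B`. With the converse below, invariance at
one point of a connected chart domain amounts to invariance over all of it. -/
theorem IsInvariantGerm.isInvariantOver (hn : finrank ℂ F = n)
    (hf : IsMeromorphicFun (𝓘(ℂ, E).prod 𝓘(ℂ, F)) f) (hB : IsPreconnected B) (hBo : IsOpen B)
    (hBD : B ⊆ chartDomain E F V p₀) (hBU : ∀ y ∈ B, (chartAt E p₀).symm y ∈ U)
    (hs : s ∈ Λ.sec U) {y : E} (hy : y ∈ B) {x : M} (hx : x ∈ U)
    (hxy : (chartAt E p₀).symm y = x) (h : Λ.IsInvariantGerm f ⟨x, s ⟨x, hx⟩⟩) (t : ℝ) :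
    IsInvariantOver (readInChart E f p₀) B fun y => (t : ℂ) • readSection F s p₀ y := by
  have : CompleteSpace F := FiniteDimensional.complete ℂ F
  subst hxy
  obtain ⟨U', hx', s', hs', heq, hper⟩ := h
  have hev := Λ.eventually_eq_of_eq hn hs hs' hx hx' heq.symm
  refine .of_eventually hB (fun y hy w => isMeromorphicNear_readInChart hf (hBD hy) w)
    (fun y hy => analyticAt_const.smul (analyticAt_readSection (Λ.holomorphic U s hs) (hBD hy)
      (hBU y hy))) (z := (y, 0)) hy ?_
  have hc : Tendsto (fun u : E × F => (chartAt E p₀).symm u.1) (𝓝 (y, 0))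
      (𝓝 ((chartAt E p₀).symm y)) :=
    ((chartAt E p₀).continuousAt_symm (hBD hy).1).tendsto.comp continuous_fst.continuousAt
  filter_upwards [hc.eventually hev,
    continuous_fst.continuousAt.preimage_mem_nhds (hBo.mem_nhds hy)] with u hu huB
  have huB : u.1 ∈ B := huB
  obtain ⟨h1, h2, h3⟩ := hu
  have h4 := hper ⟨_, h2⟩ t
  rw [← h3, isFibrePeriod_iff f (hBD huB), map_smul, ← readSection_apply s (hBD huB) h1] at h4
  exact h4 u.2

omit [FiniteDimensional ℂ F] in
theorem isInvariantGerm_of_isInvariantOver (hBo : IsOpen B)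
    (hBD : B ⊆ chartDomain E F V p₀) (hBU : ∀ y ∈ B, (chartAt E p₀).symm y ∈ U)
    (hs : s ∈ Λ.sec U) {y : E} (hy : y ∈ B) {x : M} (hx : x ∈ U)
    (hxy : (chartAt E p₀).symm y = x)
    (h : ∀ t : ℝ, IsInvariantOver (readInChart E f p₀) B
      fun y => (t : ℂ) • readSection F s p₀ y) :
    Λ.IsInvariantGerm f ⟨x, s ⟨x, hx⟩⟩ := by
  subst hxy
  let O : TopologicalSpace.Opens M :=
    ⟨(chartAt E p₀).source ∩ (chartAt E p₀) ⁻¹' B, (chartAt E p₀).isOpen_inter_preimage hBo⟩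
  have hOB : ∀ x ∈ O, ∃ y ∈ B, (chartAt E p₀).symm y = x := fun x hx =>
    ⟨_, hx.2, (chartAt E p₀).left_inv hx.1⟩
  have hOU : O ≤ U := fun x hx => by
    obtain ⟨y, hy, rfl⟩ := hOB x hx
    exact hBU y hy
  have hyO : (chartAt E p₀).symm y ∈ O := by
    refine ⟨(chartAt E p₀).map_target (hBD hy).1, ?_⟩
    rw [mem_preimage, (chartAt E p₀).right_inv (hBD hy).1]
    exact hy
  refine ⟨O, hyO, _, Λ.restrict U O hOU s hs, rfl, ?_⟩
  rintro ⟨x, hx⟩ t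
  obtain ⟨y, hy, rfl⟩ := hOB x hx
  rw [isFibrePeriod_iff f (hBD hy), map_smul, ← readSection_apply s (hBD hy) (hBU y hy)]
  exact fun w => h t y hy w

end Chart

theorem exists_nhds_isInvariantGerm (hn : finrank ℂ F = n) (Λ : LatticeSheaf E F V n)
    {f : TotalSpace F V → ℂ} (hf : IsMeromorphicFun (𝓘(ℂ, E).prod 𝓘(ℂ, F)) f)
    {U : TopologicalSpace.Opens M} {s : ∀ x : U, V x} (hs : s ∈ Λ.sec U) {x₀ : M} (hx₀ : x₀ ∈ U) :
    ∃ O ∈ 𝓝 x₀, ∀ x ∈ O, ∀ x' ∈ O, ∀ (hx : x ∈ U) (hx' : x' ∈ U),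
      Λ.IsInvariantGerm f ⟨x, s ⟨x, hx⟩⟩ → Λ.IsInvariantGerm f ⟨x', s ⟨x', hx'⟩⟩ := by
  obtain ⟨r, hr, hBD, hBU⟩ := exists_ball_subset_chartDomain (E := E) F V x₀
    (U.isOpen.mem_nhds hx₀)
  refine ⟨(chartAt E x₀).source ∩ (chartAt E x₀) ⁻¹' Metric.ball (chartAt E x₀ x₀) r,
    ((chartAt E x₀).isOpen_inter_preimage Metric.isOpen_ball).mem_nhds
      ⟨mem_chart_source E x₀, Metric.mem_ball_self hr⟩, fun x hx x' hx' hxU hxU' h => ?_⟩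
  exact isInvariantGerm_of_isInvariantOver Metric.isOpen_ball hBD hBU hs hx'.2 hxU'
    ((chartAt E x₀).left_inv hx'.1) fun t => h.isInvariantOver hn hf
      (convex_ball _ _).isPreconnected Metric.isOpen_ball hBD hBU hs hx.2 hxU
      ((chartAt E x₀).left_inv hx.1) t

/-- Along a path the condition is locally all or nothing, so it holds on a clopen set of times.
Applied to loops, this makes the group of invariant lattice vectors stable under monodromy. -/
theorem IsTransport.isInvariantGerm (hn : finrank ℂ F = n) {Λ : LatticeSheaf E F V n}
    {f : TotalSpace F V → ℂ} (hf : IsMeromorphicFun (𝓘(ℂ, E).prod 𝓘(ℂ, F)) f) {p q : M}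
    {γ : Path p q} {v : Λ.stalk p} {w : Λ.stalk q} (h : Λ.IsTransport γ v w)
    (hv : Λ.IsInvariantGerm f ⟨p, v⟩) : Λ.IsInvariantGerm f ⟨q, w⟩ := by
  obtain ⟨c, hc, h0, h1⟩ := h
  have hloc : ∀ t₀ : unitInterval, ∃ N ∈ 𝓝 t₀, ∀ t ∈ N, ∀ t' ∈ N,
      Λ.IsInvariantGerm f (c t) → Λ.IsInvariantGerm f (c t') := by
    intro t₀
    obtain ⟨U, s, hs⟩ := hc t₀
    obtain ⟨ht₀, -⟩ := hs.self_of_nhds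
    obtain ⟨O, hO, hOs⟩ := Λ.exists_nhds_isInvariantGerm hn hf s.2 ht₀
    refine ⟨_, inter_mem hs (γ.continuous.continuousAt.preimage_mem_nhds hO), ?_⟩
    rintro t ⟨⟨ht, hct⟩, htO⟩ t' ⟨⟨ht', hct'⟩, htO'⟩
    rw [hct, hct']
    exact hOs _ htO _ htO' ht ht'
  have hclopen : IsClopen {t | Λ.IsInvariantGerm f (c t)} := by
    constructor
    · rw [← isOpen_compl_iff, isOpen_iff_mem_nhds]
      intro t ht
      obtain ⟨N, hN, hNs⟩ := hloc t
      filter_upwards [hN] with t' ht' hcon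
      exact ht (hNs t' ht' t (mem_of_mem_nhds hN) hcon)
    · rw [isOpen_iff_mem_nhds]
      intro t ht
      obtain ⟨N, hN, hNs⟩ := hloc t
      filter_upwards [hN] with t' ht'
      exact hNs t (mem_of_mem_nhds hN) t' ht' ht
  have huniv := hclopen.eq_univ ⟨0, show Λ.IsInvariantGerm f (c 0) by rw [h0]; exact hv⟩
  have : (1 : unitInterval) ∈ {t | Λ.IsInvariantGerm f (c t)} := by rw [huniv]; trivial
  have h2 : Λ.IsInvariantGerm f (c 1) := this
  rwa [h1] at h2

end LatticeSheaf

end Sheaf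

/-! ### Constancy on the fibres near `p` and its propagation over the base -/

section Main

open Module

variable {E : Type*} [NormedAddCommGroup E] [NormedSpace ℂ E] [FiniteDimensional ℂ E]
  {F : Type*} [NormedAddCommGroup F] [NormedSpace ℂ F] [FiniteDimensional ℂ F] {n : ℕ}
  {M : Type*} [TopologicalSpace M] [ChartedSpace E M] [IsManifold 𝓘(ℂ, E) ω M]
  {V : M → Type*} [∀ x, AddCommGroup (V x)] [∀ x, Module ℂ (V x)]
  [TopologicalSpace (TotalSpace F V)] [∀ x, TopologicalSpace (V x)]
  [FiberBundle F V] [VectorBundle ℂ F V] [ContMDiffVectorBundle ω F V 𝓘(ℂ, E)]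

omit [FiniteDimensional ℂ E] in
/-- A function with every vector as a period on generic fibres has every vector as a period on all
fibres. -/
theorem forall_isInvariantOver_const {f : E × F → ℂ} {B : Set E} (hBo : IsOpen B)
    (h : ∀ B' : Set E, IsOpen B' → B' ⊆ B → B'.Nonempty → ∃ y ∈ B', ∀ w v : F,
      AnalyticAt ℂ f (y, w) → AnalyticAt ℂ f (y, w + v) → f (y, w + v) = f (y, w))
    (v : F) : IsInvariantOver f B fun _ => v := by
  have : CompleteSpace F := FiniteDimensional.complete ℂ F
  intro y hy w h1 h2
  by_contra hne
  have c1 : Tendsto (fun y' : E => (y', w)) (𝓝 y) (𝓝 (y, w)) :=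
    (by fun_prop : Continuous fun y' : E => (y', w)).tendsto y
  have c2 : Tendsto (fun y' : E => (y', w + v)) (𝓝 y) (𝓝 (y, w + v)) :=
    (by fun_prop : Continuous fun y' : E => (y', w + v)).tendsto y
  -- A failure at `y` persists over an open set of base points, which must contain a generic fibre.
  have hev : ∀ᶠ y' in 𝓝 y, y' ∈ B ∧ AnalyticAt ℂ f (y', w) ∧ AnalyticAt ℂ f (y', w + v) ∧
      f (y', w + v) ≠ f (y', w) := by
    filter_upwards [hBo.mem_nhds hy, c1.eventually h1.eventually_analyticAt,
      c2.eventually h2.eventually_analyticAt, ((h2.continuousAt.tendsto.comp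
          c2).prodMk_nhds (h1.continuousAt.tendsto.comp c1)).eventually
          (isOpen_ne_fun continuous_fst continuous_snd |>.mem_nhds hne)] with y' a1 a2 a3 a4
    exact ⟨a1, a2, a3, a4⟩
  obtain ⟨B', hB', hB'o, hyB'⟩ := eventually_nhds_iff.1 hev
  obtain ⟨y', hy', hall⟩ := h B' hB'o (fun z hz => (hB' z hz).1) ⟨y, hyB'⟩
  obtain ⟨-, a2, a3, a4⟩ := hB' y' hy'
  exact a4 (hall w v a2 a3)

/-- The analytic and the lattice arguments meet here: a frame of `Λ` near `p` identifies all nearby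
stalks with `ℤ ^ (2 * n)`, so that the sublattice `L` found on a generic fibre can be moved by the
monodromy at `p`. -/
theorem eventually_forall_isFibrePeriod (hn : finrank ℂ F = n)
    (Λ : LatticeSheaf E F V n) (ψ : Λ.SymplecticForm) (p : M) (δ : Fin n → Λ.stalk p)
    (hmono : ∀ i, Λ.IsMonodromy (ψ.transvection (δ i)))
    (hiso : ∀ i j, ψ.form p (δ i) (δ j) = 0)
    (hbasis : ∀ (q : M) (γ : Path p q) (w : Fin n → Λ.stalk q),
      (∀ i, Λ.IsTransport γ (δ i) (w i)) → LinearIndependent ℂ (fun i => (w i : V q)))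
    (f : TotalSpace F V → ℂ) (hf : IsMeromorphicFun (𝓘(ℂ, E).prod 𝓘(ℂ, F)) f)
    (hper : Λ.IsPeriodic f) (W : ∀ q, Submodule ℂ (V q))
    (hW : ∀ (q : M) (γ : Path p q) (w : Λ.stalk q),
      Λ.IsTransport γ (∑ i : Fin n, ((i : ℕ) + 1) • δ i) w → (w : V q) ∈ W q)
    (hconst : IsConstantOnCosets E f W) :
    ∀ᶠ x in 𝓝 p, ∀ l : V x, IsFibrePeriod E f l := by
  have : CompleteSpace F := FiniteDimensional.complete ℂ F
  obtain ⟨U, hp, b, hb, -, hstalk⟩ := Λ.exists_frame hn p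
  obtain ⟨r, hr, hBD, hBU⟩ := exists_ball_subset_chartDomain (E := E) F V p (U.isOpen.mem_nhds hp)
  set B := Metric.ball (chartAt E p p) r with hBdef
  have hBo : IsOpen B := Metric.isOpen_ball
  have hB : IsPreconnected B := (convex_ball _ _).isPreconnected
  have hpB : chartAt E p p ∈ B := Metric.mem_ball_self hr
  have hpp : (chartAt E p).symm (chartAt E p p) = p :=
    (chartAt E p).left_inv (mem_chart_source E p)
  have hmero : ∀ y ∈ B, ∀ w, IsMeromorphicNear (readInChart E f p) (y, w) := fun y hy w =>
    isMeromorphicNear_readInChart hf (hBD hy) w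
  -- the sections with constant coordinates in the frame
  let sec : (Fin (2 * n) → ℤ) → Λ.sec U := fun c => ∑ i, c i • ⟨b i, hb i⟩
  have hsec : ∀ c (x : U), (sec c).1 x = ∑ i, c i • b i x := fun c x => by
    simp [sec, Finset.sum_apply]
  let ev : E → (Fin (2 * n) → ℤ) →ₗ[ℤ] F := fun y =>
    Fintype.linearCombination ℤ fun i => readSection F (b i) p y
  have hev : ∀ c, ∀ y (hy : y ∈ B),
      ev y c = fibreEquiv p (hBD hy) ((sec c).1 ⟨_, hBU y hy⟩) := fun c y hy => by
    simp only [ev, Fintype.linearCombination_apply, hsec, map_sum, map_zsmul]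
    exact Finset.sum_congr rfl fun i _ => by rw [readSection_apply (b i) (hBD hy) (hBU y hy)]
  have hevs : ∀ c, ∀ y ∈ B, ev y c = readSection F (sec c).1 p y := fun c y hy => by
    rw [hev c y hy, readSection_apply _ (hBD hy) (hBU y hy)]
  have hev_an : ∀ c, AnalyticOnNhd ℂ (fun y => ev y c) B := fun c y hy => by
    refine (analyticAt_readSection (Λ.holomorphic U _ (sec c).2) (hBD hy) (hBU y hy)).congr ?_
    filter_upwards [hBo.mem_nhds hy] with z hz
    exact (hevs c z hz).symm
  have hev_per : ∀ c, IsInvariantOver (readInChart E f p) B fun y => ev y c := fun c y hy w => by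
    have h1 : IsFibrePeriod E f ((sec c).1 ⟨_, hBU y hy⟩) := fun v =>
      hper _ v (Λ.germ (sec c) ⟨_, hBU y hy⟩)
    rw [isFibrePeriod_iff f (hBD hy), ← hev c y hy] at h1
    exact h1 w
  have hev_span : ∀ y ∈ B, Submodule.span ℝ (range (ev y)) = ⊤ := fun y hy => by
    rw [← Λ.span_real_image (fibreEquiv p (hBD hy))]
    congr 1
    ext v
    constructor
    · rintro ⟨c, rfl⟩
      exact ⟨_, (Λ.germ (sec c) ⟨_, hBU y hy⟩).2, (hev c y hy).symm⟩
    · rintro ⟨l, hl, rfl⟩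
      obtain ⟨c, rfl⟩ := ((hstalk ⟨_, hBU y hy⟩).1 l).1 hl
      exact ⟨c, by rw [hev c y hy, hsec]⟩
  -- the isomorphism of `ℤ ^ (2 * n)` with the stalk at `p`
  let ev₀ : (Fin (2 * n) → ℤ) →ₗ[ℤ] Λ.stalk p :=
    Fintype.linearCombination ℤ fun i => Λ.germ ⟨b i, hb i⟩ ⟨p, hp⟩
  have hev₀ : ∀ c, ev₀ c = Λ.germ (sec c) ⟨p, hp⟩ := fun c => by
    refine Subtype.ext ?_
    change _ = (sec c).1 ⟨p, hp⟩
    rw [hsec]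
    simp only [ev₀, Fintype.linearCombination_apply, AddSubgroup.val_finsetSum]
    rfl
  have hev₀_inj : ∀ c, ev₀ c = 0 → c = 0 := fun c hc => by
    have h1 : ∑ i, c i • b i ⟨p, hp⟩ = 0 := by
      rw [← hsec]
      exact congrArg Subtype.val ((hev₀ c).symm.trans hc)
    exact funext (Fintype.linearIndependent_iff.1 (hstalk ⟨p, hp⟩).2 c h1)
  have hev₀_surj : Function.Surjective ev₀ := fun l => by
    obtain ⟨c, hc⟩ := ((hstalk ⟨p, hp⟩).1 l).1 l.2
    refine ⟨c, (hev₀ c).trans (Subtype.ext ?_)⟩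
    exact (hsec c _).trans hc
  choose d hd using fun i => hev₀_surj (δ i)
  let ψ' : (Fin (2 * n) → ℤ) →ₗ[ℤ] (Fin (2 * n) → ℤ) →ₗ[ℤ] ℤ :=
    LinearMap.mk₂ ℤ (fun c c' => ψ.form p (ev₀ c) (ev₀ c'))
      (fun _ _ _ => by simp) (fun _ _ _ => by rw [map_zsmul, map_zsmul]; rfl)
      (fun _ _ _ => by simp) (fun _ _ _ => by rw [map_zsmul, map_zsmul])
  have hψ' : ∀ c c', ψ' c c' = ψ.form p (ev₀ c) (ev₀ c') := fun c c' => rfl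
  -- paths inside the chart
  have hpath : ∀ y ∈ B, ∃ γ : Path p ((chartAt E p).symm y), ∀ t, γ t ∈ U := fun y hy => by
    have h1 : IsPathConnected B := (convex_ball _ _).isPathConnected ⟨_, hpB⟩
    have h2 : IsPathConnected ((chartAt E p).symm '' B) :=
      h1.image' ((chartAt E p).continuousOn_symm.mono fun z hz => (hBD hz).1)
    obtain ⟨γ, hγ⟩ := h2.joinedIn p ⟨_, hpB, hpp⟩ _ ⟨y, hy, rfl⟩
    refine ⟨γ, fun t => ?_⟩
    obtain ⟨z, hz, hzt⟩ := hγ t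
    rw [← hzt]
    exact hBU z hz
  have htr : ∀ y (hy : y ∈ B) (γ : Path p ((chartAt E p).symm y)), (∀ t, γ t ∈ U) → ∀ c,
      Λ.IsTransport γ (ev₀ c) (Λ.germ (sec c) ⟨_, hBU y hy⟩) := fun y hy γ hγ c => by
    rw [hev₀]
    exact Λ.isTransport_germ (sec c) γ hγ hp (hBU y hy)
  have hli : ∀ y ∈ B, LinearIndependent ℂ (ev y ∘ d) := fun y hy => by
    obtain ⟨γ, hγ⟩ := hpath y hy
    have h1 := hbasis _ γ (fun i => Λ.germ (sec (d i)) ⟨_, hBU y hy⟩) fun i => by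
      rw [← hd i]
      exact htr y hy γ hγ (d i)
    have h2 := h1.map' (fibreEquiv p (hBD hy)).toLinearEquiv.toLinearMap (LinearEquiv.ker _)
    have h3 : ev y ∘ d = (fibreEquiv p (hBD hy)).toLinearEquiv.toLinearMap ∘
        fun i => (Λ.germ (sec (d i)) ⟨_, hBU y hy⟩ : V ((chartAt E p).symm y)) :=
      funext fun i => hev (d i) y hy
    rw [h3]
    exact h2
  -- Membership in `L` becomes a condition on germs at `p`, where the monodromy acts, although the
  -- generic fibre lies over another point `y`.
  have hgerm : ∀ c, (∀ t : ℝ, IsInvariantOver (readInChart E f p) B fun y => (t : ℂ) • ev y c) ↔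
      Λ.IsInvariantGerm f ⟨p, ev₀ c⟩ := fun c => by
    have h0 : ∀ t : ℝ, (IsInvariantOver (readInChart E f p) B fun y => (t : ℂ) • ev y c) ↔
        IsInvariantOver (readInChart E f p) B
          fun y => (t : ℂ) • readSection F (sec c).1 p y := fun t => by
      refine forall₂_congr fun y hy => ?_
      simp only [hevs c y hy]
    simp only [h0, hev₀]
    exact ⟨fun h => LatticeSheaf.isInvariantGerm_of_isInvariantOver hBo hBD hBU (sec c).2 hpB hp
      hpp h, fun h => h.isInvariantOver hn hf hB hBo hBD hBU (sec c).2 hpB hp hpp⟩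
  have hgeneric : ∀ B' : Set E, IsOpen B' → B' ⊆ B → B'.Nonempty → ∃ y ∈ B', ∀ w v : F,
      AnalyticAt ℂ (readInChart E f p) (y, w) → AnalyticAt ℂ (readInChart E f p) (y, w + v) →
        readInChart E f p (y, w + v) = readInChart E f p (y, w) := by
    intro B' hB'o hB'B hB'ne
    obtain ⟨y, hy, G, hG, L, hL, hsat, hLG, hrank⟩ := exists_fibre_finrank_le hBo hB hmero ev
      hev_an hev_per hev_span (by rw [finrank_fin_fun, hn]) hB'o hB'B hB'ne
    refine ⟨y, hy, fun w v => ?_⟩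
    have hyB := hB'B hy
    have hdL : ∀ i, d i ∈ L := by
      refine mem_of_transvection_stable (finrank_fin_fun ℤ) hn ψ' (fun c => ψ.alternating p _)
        (fun c hc => hev₀_inj c (ψ.nondegenerate p _ fun l => ?_)) (ev y) d (hli y hyB)
        (fun i j => by rw [hψ', hd, hd, hiso]) L hsat (fun i c hc => ?_) ?_ hrank
      · obtain ⟨c', rfl⟩ := hev₀_surj l
        exact hc c'
      · rw [hL, hgerm] at hc ⊢
        obtain ⟨γ, hγ⟩ := hmono i
        have h1 := (hγ (ev₀ c)).isInvariantGerm hn hf hc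
        have h2 : ψ.transvection (δ i) (ev₀ c) = ev₀ (c + ψ' c (d i) • d i) := by
          rw [map_add, map_zsmul, hψ', hd]
          rfl
        rwa [h2] at h1
      · rw [hL]
        intro t z hz
        obtain ⟨γ, hγ⟩ := hpath z hz
        have h1 := htr z hz γ hγ (∑ i : Fin n, ((i : ℕ) + 1) • d i)
        have h2 : ev₀ (∑ i : Fin n, ((i : ℕ) + 1) • d i) = ∑ i : Fin n, ((i : ℕ) + 1) • δ i := by
          rw [map_sum]
          exact Finset.sum_congr rfl fun i _ => by rw [map_nsmul, hd]
        rw [h2] at h1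
        -- All multiples of the continued `δ` stay in `W`, so constancy on cosets makes them periods
        -- on each fibre over `B`.
        have h3 := (W _).smul_mem (t : ℂ) (hW _ γ _ h1)
        have h4 : IsFibrePeriod E f ((t : ℂ) • (sec (∑ i : Fin n, ((i : ℕ) + 1) • d i)).1
            ⟨_, hBU z hz⟩) := fun v a1 a2 =>
          (hconst _ v _ (by rw [add_sub_cancel_left]; exact h3) a1 a2).symm
        rw [isFibrePeriod_iff f (hBD hz), map_smul, ← hev _ z hz] at h4
        exact h4
    have hspan : Submodule.span ℂ (range (ev y ∘ d)) = ⊤ :=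
      (hli y hyB).span_eq_top_of_card_eq_finrank' (by simp [hn])
    -- Complex multiples of the `d i` are periods and the `d i` span the fibre over `ℂ`, so every
    -- vector is a period.
    have hvG : v ∈ G := by
      have hv : v ∈ Submodule.span ℂ (range (ev y ∘ d)) := by rw [hspan]; trivial
      obtain ⟨a, rfl⟩ := Submodule.mem_span_range_iff_exists_fun ℂ |>.1 hv
      exact G.sum_mem fun i _ => hLG _ (hdL i) _
    exact (hG v).1 hvG w
  have hinv := forall_isInvariantOver_const hBo hgeneric
  have hnhds : (chartAt E p).source ∩ (chartAt E p) ⁻¹' B ∈ 𝓝 p :=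
    ((chartAt E p).isOpen_inter_preimage hBo).mem_nhds ⟨mem_chart_source E p, hpB⟩
  filter_upwards [hnhds] with x hx
  rw [← (chartAt E p).left_inv hx.1]
  intro l
  rw [isFibrePeriod_iff f (hBD hx.2)]
  exact hinv _ _ hx.2

omit [FiniteDimensional ℂ E] in
/-- If all vectors are periods of `f` on the fibres over an open set, they are periods
on all fibres. -/
theorem forall_isFibrePeriod_of_eventually [PreconnectedSpace M] {f : TotalSpace F V → ℂ}
    (hf : IsMeromorphicFun (𝓘(ℂ, E).prod 𝓘(ℂ, F)) f) {p : M}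
    (hp : ∀ᶠ x in 𝓝 p, ∀ l : V x, IsFibrePeriod E f l) (q : M) (l : V q) :
    IsFibrePeriod E f l := by
  have : CompleteSpace F := FiniteDimensional.complete ℂ F
  have hopen : IsOpen {q : M | ∀ᶠ x in 𝓝 q, ∀ l : V x, IsFibrePeriod E f l} :=
    isOpen_setOfPred_eventually_nhds
  have huniv : {q : M | ∀ᶠ x in 𝓝 q, ∀ l : V x, IsFibrePeriod E f l} = univ := by
    refine IsClopen.eq_univ ⟨isClosed_of_closure_subset fun q hq => ?_, hopen⟩ ⟨p, hp⟩
    obtain ⟨r, hr, hBD, -⟩ := exists_ball_subset_chartDomain (E := E) F V q univ_mem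
    set B := Metric.ball (chartAt E q q) r with hBdef
    have hnhds : (chartAt E q).source ∩ (chartAt E q) ⁻¹' B ∈ 𝓝 q :=
      ((chartAt E q).isOpen_inter_preimage Metric.isOpen_ball).mem_nhds
        ⟨mem_chart_source E q, Metric.mem_ball_self hr⟩
    obtain ⟨q', ⟨hq's, hq'B⟩, hq'⟩ := mem_closure_iff_nhds.1 hq _ hnhds
    have hq'B : chartAt E q q' ∈ B := hq'B
    -- In the trivialization at `q`, every vector is the value of a constant, hence analytic,
    -- section; its invariance near `q'` spreads over the ball around `q`.
    have hinv : ∀ v : F, IsInvariantOver (readInChart E f q) B fun _ => v := fun v => by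
      refine .of_eventually (convex_ball _ _).isPreconnected
        (fun y hy w => isMeromorphicNear_readInChart hf (hBD hy) w)
        (fun _ _ => analyticAt_const) (z := (chartAt E q q', 0)) hq'B ?_
      have hc : Tendsto (fun u : E × F => (chartAt E q).symm u.1) (𝓝 (chartAt E q q', 0))
          (𝓝 q') := by
        have := ((chartAt E q).continuousAt_symm (hBD hq'B).1).tendsto
        rw [(chartAt E q).left_inv hq's] at this
        exact this.comp continuous_fst.continuousAt
      filter_upwards [hc.eventually hq', continuous_fst.continuousAt.preimage_mem_nhds
        (Metric.isOpen_ball.mem_nhds hq'B)] with u hu huB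
      have huB : u.1 ∈ B := huB
      have h1 := hu ((fibreEquiv q (hBD huB)).symm v)
      rw [isFibrePeriod_iff f (hBD huB), ContinuousLinearEquiv.apply_symm_apply] at h1
      exact h1 u.2
    change ∀ᶠ x in 𝓝 q, ∀ l : V x, IsFibrePeriod E f l
    filter_upwards [hnhds] with x hx
    rw [← (chartAt E q).left_inv hx.1]
    intro l
    rw [isFibrePeriod_iff f (hBD hx.2)]
    exact hinv _ _ hx.2
  have hq : q ∈ {q : M | ∀ᶠ x in 𝓝 q, ∀ l : V x, IsFibrePeriod E f l} := by rw [huniv]; trivial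
  have hq : ∀ᶠ x in 𝓝 q, ∀ l : V x, IsFibrePeriod E f l := hq
  exact hq.self_of_nhds l

end Main

theorem lemma3p7p3
    {E : Type*} [NormedAddCommGroup E] [NormedSpace ℂ E] [FiniteDimensional ℂ E]
    {F : Type*} [NormedAddCommGroup F] [NormedSpace ℂ F] [FiniteDimensional ℂ F]
    {n : ℕ} (hn : Module.finrank ℂ F = n)
    -- the connected complex manifold `M`
    {M : Type*} [TopologicalSpace M] [T2Space M] [ConnectedSpace M]
    [ChartedSpace E M] [IsManifold 𝓘(ℂ, E) ω M]
    -- the holomorphic vector bundle `V` of rank `n` over `M`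
    {V : M → Type*} [∀ x, AddCommGroup (V x)] [∀ x, Module ℂ (V x)]
    [TopologicalSpace (TotalSpace F V)] [∀ x, TopologicalSpace (V x)]
    [FiberBundle F V] [VectorBundle ℂ F V] [ContMDiffVectorBundle ω F V 𝓘(ℂ, E)]
    -- the sheaf of lattices with its symplectic form
    (Λ : LatticeSheaf E F V n) (ψ : Λ.SymplecticForm)
    (p : M) (δ : Fin n → Λ.stalk p)
    (hmono : ∀ i, Λ.IsMonodromy (ψ.transvection (δ i)))
    (hiso : ∀ i j, ψ.form p (δ i) (δ j) = 0)
    (hbasis : ∀ (q : M) (γ : Path p q) (w : Fin n → Λ.stalk q),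
      (∀ i, Λ.IsTransport γ (δ i) (w i)) →
        LinearIndependent ℂ (fun i => (w i : V q)) ∧
          Submodule.span ℂ (range fun i => (w i : V q)) = ⊤)
    -- the fibrewise periodic meromorphic function `f`
    (f : TotalSpace F V → ℂ)
    (hf : IsMeromorphicFun (𝓘(ℂ, E).prod 𝓘(ℂ, F)) f) (hper : Λ.IsPeriodic f)
    -- the subbundle generated by `δ₁ + 2 δ₂ + ⋯ + n δₙ` is good
    (W : ∀ q, Submodule ℂ (V q))
    (hW : Λ.IsSubbundleGeneratedBy (∑ i : Fin n, ((i : ℕ) + 1) • δ i) W)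
    (hgood : Λ.IsGood f W) :
    -- `f` is constant on every fibre
    ∀ (q : M) (v v' : V q),
      (⟨q, v⟩ : TotalSpace F V) ∈ regularLocus (𝓘(ℂ, E).prod 𝓘(ℂ, F)) f →
      (⟨q, v'⟩ : TotalSpace F V) ∈ regularLocus (𝓘(ℂ, E).prod 𝓘(ℂ, F)) f →
      f ⟨q, v⟩ = f ⟨q, v'⟩ := by
  intro q v v' h1 h2
  have hp := eventually_forall_isFibrePeriod hn Λ ψ p δ hmono hiso
    (fun q γ w hw => (hbasis q γ w hw).1) f hf hper W hW.1.2 hgood.2.1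
  have := forall_isFibrePeriod_of_eventually hf hp q (v' - v) v h1 (by rwa [add_sub_cancel])
  rw [add_sub_cancel] at this
  exact this.symm
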